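/- Let $r\ge 2$ be a natural number and let $k$ be an integer. An integer $n$ is called $r$-free if $p^r\nmid n$ for all primes $p$ (in particular $0$ is not $r$-free). For real $H\ge 1$ let $R(H,r,k)$ be the number of triples of integers $(x,y,z)$ with $1\le x,y,z\le H$ such that $x^2+y^2+z^2+k$ is $r$-free. For a positive integer $q$ let $$\lambda(q;k)=\#\{(x,y,z)\in\mathbb Z^3:\ 1\le x,y,z\le q,\ x^2+y^2+z^2+k\equiv 0 \pmod q\}.$$ Then the product $\prod_p\left(1-\frac{\lambda(p^r;k)}{p^{3r}}\right)$ over all primes $p$ converges unconditionally, and for every $\varepsilon>0$ the following hold for all real $H\ge 1$, with implied constants depending only on $r$, $k$ and $\varepsilon$. (i) If $k\ne 0$, then $$R(H,r,k)=\prod_p\left(1-\frac{\lambda(p^r;k)}{p^{3r}}\right)H^3+O\left(H^{2}+H^{\frac32+\frac{3}{2r}+\varepsilon}\right).$$ (ii) If $k=0$, then $$R(H,r,0)=\prod_p\left(1-\frac{\lambda(p^r;0)}{p^{3r}}\right)H^3+O\left(H^{2+\varepsilon}+H^{\frac{9r}{5r-2}+\varepsilon}\right).$$ -/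

import Mathlib

namespace RFreeValues

/-- An integer `n` is `r`-free if `p ^ r ∤ n` for all primes `p` (so `0` is not `r`-free). -/
def IsRFree (r : ℕ) (n : ℤ) : Prop :=
  ∀ p : ℕ, p.Prime → ¬ ((p : ℤ) ^ r ∣ n)

/-- The number of triples of positive integers `x, y, z ≤ H` (`H` real) for which
`x ^ 2 + y ^ 2 + z ^ 2 + k` is `r`-free. -/
noncomputable def R (H : ℝ) (r : ℕ) (k : ℤ) : ℕ :=
  open Classical in
  ((Finset.Icc 1 ⌊H⌋₊ ×ˢ Finset.Icc 1 ⌊H⌋₊ ×ˢ Finset.Icc 1 ⌊H⌋₊).filter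
    fun t : ℕ × ℕ × ℕ =>
      IsRFree r ((t.1 : ℤ) ^ 2 + (t.2.1 : ℤ) ^ 2 + (t.2.2 : ℤ) ^ 2 + k)).card

/-- The number of triples `1 ≤ x, y, z ≤ q` with `x ^ 2 + y ^ 2 + z ^ 2 + k ≡ 0 (mod q)`. -/
def lam (q : ℕ) (k : ℤ) : ℕ :=
  ((Finset.Icc 1 q ×ˢ Finset.Icc 1 q ×ˢ Finset.Icc 1 q).filter
    fun t : ℕ × ℕ × ℕ =>
      (t.1 : ℤ) ^ 2 + (t.2.1 : ℤ) ^ 2 + (t.2.2 : ℤ) ^ 2 + k ≡ 0 [ZMOD (q : ℤ)]).card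

/-- The factor `1 - λ(p ^ r; k) / p ^ (3 r)` of the Euler product at the prime `p`. -/
noncomputable def eulerFactor (r : ℕ) (k : ℤ) (p : Nat.Primes) : ℝ :=
  1 - (lam ((p : ℕ) ^ r) k : ℝ) / ((p : ℕ) : ℝ) ^ (3 * r)

end RFreeValues

/-!
With `N = ⌊H⌋`, Möbius inversion writes `R(H, r, k)` as the sum over `d` of `μ(d)` times the number
of `x ∈ [1, N] ^ 3` such that `Q(x) = x₁² + x₂² + x₃² + k` is a nonzero multiple of `q = d ^ r`.

For small `d` that number is expanded into additive characters modulo `q`. The zero frequency gives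
the main term `N ^ 3 λ(q; k) / q ^ 3`; at a frequency `u ≠ 0` the exponential sum over `Q(x) ≡ 0`
exhibits square-root cancellation, except at the sparse *resonant* frequencies, where it may be
larger. The interval sums decay in every coordinate of `u`, and the total error is
`O(d ^ η (N ^ 2 / q + q))`. For large `d` one fixes the multiple of `q` and `x₁`; the number of
representations of what remains as a sum of two squares is `O(N ^ η)`, so that the count is
`O(N ^ (3 + η) / q)`. The singular series `∑ μ(d) λ(d ^ r; k) / d ^ (3 r)` is the Euler product, and
the cut-off `d ≤ H ^ (3 / (2 r))` balances the two ranges.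
-/

namespace RFreeValues

open Finset
open scoped Matrix

theorem card_smul_sum_comp_of_surjective {G H M : Type*} [AddCommGroup G] [AddCommGroup H]
    [Fintype G] [Fintype H] [AddCommMonoid M] {φ : G →+ H} (hφ : Function.Surjective φ)
    (F : H → M) :
    Fintype.card H • ∑ x, F (φ x) = Fintype.card G • ∑ y, F y := by
  have translate (h : H) : ∑ x, F (φ x) = ∑ x, F (φ x + h) := by
    obtain ⟨g, rfl⟩ := hφ h
    simp only [← map_add]
    exact (Equiv.sum_comp (Equiv.addRight g) fun x => F (φ x)).symm
  calc Fintype.card H • ∑ x, F (φ x) = ∑ h : H, ∑ x, F (φ x + h) := by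
        rw [← sum_congr rfl fun h _ => translate h, sum_const, card_univ]
    _ = ∑ x : G, ∑ y, F y := by
        rw [sum_comm]
        exact sum_congr rfl fun x _ => Equiv.sum_comp (Equiv.addLeft (φ x)) F
    _ = Fintype.card G • ∑ y, F y := by rw [sum_const, card_univ]

section AdditiveCharacters

variable {ι S : Type*} [CommRing S] {ψ : AddChar S ℂ}

theorem addChar_sum_eq_prod [Fintype ι] (ψ : AddChar S ℂ) (f : ι → S) :
    ψ (∑ i, f i) = ∏ i, ψ (f i) := by
  classical
  induction (univ : Finset ι) using Finset.induction_on with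
  | empty => simp
  | insert i s hi ih => rw [sum_insert hi, prod_insert hi, AddChar.map_add_eq_mul, ih]

theorem norm_sum_addChar_le [Finite S] (s : Finset ι) (f : ι → S) :
    ‖∑ x ∈ s, ψ (f x)‖ ≤ #s := by
  refine (norm_sum_le _ _).trans (le_of_eq ?_)
  simp [AddChar.norm_apply]

variable [Fintype S]

theorem sum_units_add_sum_nonunits [DecidableEq S] [DecidablePred fun a : S => ¬ IsUnit a]
    (F : S → ℂ) :
    ∑ a : Sˣ, F a + ∑ a : S with ¬ IsUnit a, F a = ∑ a, F a := by
  classical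
  rw [← sum_filter_add_sum_filter_not univ (fun a : S => IsUnit a)]
  congr 1
  · refine (sum_bij (fun (a : Sˣ) _ => (a : S)) (by simp) (by simp [Units.val_inj]) ?_ (by simp))
    intro b hb
    exact ⟨(mem_filter.mp hb).2.unit, mem_univ _, rfl⟩

variable [Fintype ι]

theorem sum_addChar_sum [DecidableEq ι] (ψ : AddChar S ℂ) (f : ι → S → S) :
    ∑ x : ι → S, ψ (∑ i, f i (x i)) = ∏ i, ∑ y, ψ (f i y) := by
  simp only [addChar_sum_eq_prod, Fintype.prod_sum]

theorem sum_addChar_dotProduct [DecidableEq ι] [DecidableEq S] (hψ : ψ.IsPrimitive) (y : ι → S) :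
    ∑ u : ι → S, ψ (u ⬝ᵥ y) = if y = 0 then (Fintype.card S : ℂ) ^ Fintype.card ι else 0 := by
  simp only [dotProduct, sum_addChar_sum ψ fun i z => z * y i, AddChar.sum_mulShift _ hψ]
  push_cast
  rw [prod_ite_zero]
  simp [funext_iff]

end AdditiveCharacters

section QuadraticGaussSums

variable {S : Type*} [CommRing S] [Fintype S] {ψ : AddChar S ℂ}

/-- The quadratic Gauss sum of a finite commutative ring, with an arbitrary multiplier `a`. -/
noncomputable def quadGauss (ψ : AddChar S ℂ) (a : S) : ℂ := ∑ x : S, ψ (a * x ^ 2)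

theorem quadGauss_mul_sq (a : S) (c : Sˣ) : quadGauss ψ (a * (c : S) ^ 2) = quadGauss ψ a := by
  refine Fintype.sum_equiv (Units.mulLeft c) _ _ fun x => ?_
  rw [Units.mulLeft_apply, mul_pow, mul_assoc]

theorem quadGauss_inv (a : Sˣ) : quadGauss ψ (a⁻¹ : Sˣ) = quadGauss ψ a := by
  rw [← quadGauss_mul_sq _ a, ← Units.val_pow_eq_pow_val, ← Units.val_mul, sq,
    inv_mul_cancel_left]

theorem quadGauss_mul_self (c : Sˣ) : quadGauss ψ ((c * c : Sˣ) : S) = quadGauss ψ 1 := by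
  rw [← quadGauss_mul_sq 1 c, Units.val_mul, one_mul, sq]

theorem sum_addChar_sq_add_linear (a t : Sˣ) (ht : (t : S) = 2) (u : S) :
    ∑ x : S, ψ (a * x ^ 2 + u * x) = ψ (-(u ^ 2 * ((t ^ 2 * a)⁻¹ : Sˣ))) * quadGauss ψ a := by
  rw [quadGauss, mul_sum]
  refine Fintype.sum_equiv (Equiv.addRight (u * ((t * a)⁻¹ : Sˣ))) _ _ fun x => ?_
  rw [← AddChar.map_add_eq_mul, Equiv.coe_addRight]
  congr 1
  have htt : (2 : S) * (t⁻¹ : Sˣ) = 1 := ht ▸ t.mul_inv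
  simp only [mul_inv, ← inv_pow, Units.val_mul, Units.val_pow_eq_pow_val]
  linear_combination (-u * x) * htt +
    (-2 * (t⁻¹ : Sˣ) * u * x - ((t⁻¹ : Sˣ) : S) ^ 2 * (a⁻¹ : Sˣ) * u ^ 2) * a.mul_inv

theorem sum_addChar_dotProduct_self_add {ι : Type*} [Fintype ι] [DecidableEq ι] (a t : Sˣ)
    (ht : (t : S) = 2) (u : ι → S) :
    ∑ x : ι → S, ψ (a * (x ⬝ᵥ x) + u ⬝ᵥ x) =
      ψ (-((u ⬝ᵥ u) * ((t ^ 2 * a)⁻¹ : Sˣ))) * quadGauss ψ a ^ Fintype.card ι := by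
  simp only [dotProduct, mul_sum, ← sum_add_distrib, ← sq, sum_mul, ← sum_neg_distrib]
  rw [sum_addChar_sum ψ fun i z => a * z ^ 2 + u i * z, addChar_sum_eq_prod,
    ← card_univ, ← prod_const, ← prod_mul_distrib]
  exact prod_congr rfl fun i _ => sum_addChar_sq_add_linear a t ht (u i)

theorem quadGauss_mul_conj (hψ : ψ.IsPrimitive) (a t : Sˣ) (ht : (t : S) = 2) :
    quadGauss ψ a * starRingEnd ℂ (quadGauss ψ a) = Fintype.card S := by
  classical
  have shift (y : S) : quadGauss ψ a * starRingEnd ℂ (ψ (a * y ^ 2)) =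
      ∑ h : S, ψ (a * h ^ 2) * ψ (y * (2 * a * h)) := by
    rw [quadGauss, sum_mul]
    refine Fintype.sum_equiv (Equiv.subRight y) _ _ fun x => ?_
    rw [← AddChar.map_neg_eq_conj, ← AddChar.map_add_eq_mul, ← AddChar.map_add_eq_mul,
      Equiv.subRight_apply]
    congr 1
    ring
  have orthogonality (h : S) : ∑ y : S, ψ (a * h ^ 2) * ψ (y * (2 * a * h)) =
      if h = 0 then (Fintype.card S : ℂ) else 0 := by
    have hzero : 2 * (a : S) * h = 0 ↔ h = 0 := by
      rw [← ht, ← Units.val_mul, Units.mul_right_eq_zero]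
    rw [← mul_sum, AddChar.sum_mulShift _ hψ]
    by_cases hh : h = 0 <;> simp [hzero, hh]
  calc quadGauss ψ a * starRingEnd ℂ (quadGauss ψ a)
      = ∑ y : S, ∑ h : S, ψ (a * h ^ 2) * ψ (y * (2 * a * h)) := by
        conv_lhs => rw [quadGauss.eq_1 ψ a, map_sum, mul_sum, ← quadGauss.eq_1 ψ a]
        exact sum_congr rfl fun y _ => shift y
    _ = Fintype.card S := by
        rw [sum_comm, sum_congr rfl fun h _ => orthogonality h]
        simp

theorem norm_quadGauss_sq (hψ : ψ.IsPrimitive) (a t : Sˣ) (ht : (t : S) = 2) :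
    ‖quadGauss ψ a‖ ^ 2 = Fintype.card S := by
  have h := quadGauss_mul_conj hψ a t ht
  rw [Complex.mul_conj, Complex.normSq_eq_norm_sq] at h
  exact_mod_cast h

theorem quadGauss_sq (a : S) :
    quadGauss ψ a ^ 2 = ∑ x : S × S, ψ (a * (x.1 ^ 2 + x.2 ^ 2)) := by
  simp only [quadGauss, sq (Finset.sum _ _), sum_mul_sum, Fintype.sum_prod_type, mul_add,
    AddChar.map_add_eq_mul]

/-- Brahmagupta's identity: the form `x ^ 2 + y ^ 2` is equivalent to its multiple by the unit
`c ^ 2 + d ^ 2`, through this change of variables. -/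
def brahmaguptaEquiv (b : Sˣ) (c d : S) (h : (b : S) = c ^ 2 + d ^ 2) : S × S ≃ S × S where
  toFun x := (c * x.1 - d * x.2, d * x.1 + c * x.2)
  invFun x := ((b⁻¹ : Sˣ) * (c * x.1 + d * x.2), (b⁻¹ : Sˣ) * (c * x.2 - d * x.1))
  left_inv := fun ⟨x, y⟩ => Prod.ext
    (by linear_combination (x * (b⁻¹ : Sˣ)) * (-h) + x * b.mul_inv)
    (by linear_combination (y * (b⁻¹ : Sˣ)) * (-h) + y * b.mul_inv)
  right_inv := fun ⟨x, y⟩ => Prod.ext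
    (by linear_combination (x * (b⁻¹ : Sˣ)) * (-h) + x * b.mul_inv)
    (by linear_combination (y * (b⁻¹ : Sˣ)) * (-h) + y * b.mul_inv)

theorem quadGauss_sq_eq_of_eq_sq_add_sq {b : Sˣ} {c d : S} (h : (b : S) = c ^ 2 + d ^ 2) :
    quadGauss ψ b ^ 2 = quadGauss ψ 1 ^ 2 := by
  rw [quadGauss_sq, quadGauss_sq]
  refine Fintype.sum_equiv (brahmaguptaEquiv b c d h) _ _ fun x => ?_
  congr 1
  simp only [brahmaguptaEquiv, Equiv.coe_fn_mk]
  rw [h]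
  ring

theorem quadGauss_mul (hsum : ∀ b : Sˣ, ∃ c d : S, (b : S) = c ^ 2 + d ^ 2)
    (hsq : ∀ a b : Sˣ, IsSquare a ∨ IsSquare b ∨ IsSquare (a * b)) (a b : Sˣ) :
    quadGauss ψ ((a * b : Sˣ) : S) * quadGauss ψ 1 = quadGauss ψ a * quadGauss ψ b := by
  rcases hsq a b with ⟨c, rfl⟩ | ⟨c, rfl⟩ | ⟨c, hc⟩
  · rw [quadGauss_mul_self, mul_comm (c * c), ← sq c, Units.val_mul, Units.val_pow_eq_pow_val,
      quadGauss_mul_sq, mul_comm]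
  · rw [quadGauss_mul_self, ← sq c, Units.val_mul, Units.val_pow_eq_pow_val, quadGauss_mul_sq]
  · have hb : quadGauss ψ (b : S) = quadGauss ψ a := by
      rw [← quadGauss_inv b, ← quadGauss_mul_sq _ c, ← Units.val_pow_eq_pow_val, ← Units.val_mul,
        sq, ← hc, mul_comm a b, inv_mul_cancel_left]
    obtain ⟨e, f, hef⟩ := hsum a
    rw [hc, quadGauss_mul_self, hb, ← sq, ← sq, quadGauss_sq_eq_of_eq_sq_add_sq hef]

theorem quadGauss_mul_cube (hsum : ∀ b : Sˣ, ∃ c d : S, (b : S) = c ^ 2 + d ^ 2)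
    (hsq : ∀ a b : Sˣ, IsSquare a ∨ IsSquare b ∨ IsSquare (a * b)) (a b : Sˣ) :
    quadGauss ψ ((a * b : Sˣ) : S) ^ 3 = quadGauss ψ 1 * quadGauss ψ a * quadGauss ψ b := by
  obtain ⟨c, d, h⟩ := hsum (a * b)
  rw [pow_succ, quadGauss_sq_eq_of_eq_sq_add_sq h, mul_assoc _ (quadGauss ψ a),
    ← quadGauss_mul hsum hsq]
  ring

end QuadraticGaussSums

section QuadricSums

variable {ι S : Type*} [Fintype ι] [DecidableEq ι] [CommRing S] [Fintype S] [DecidableEq S]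
  {ψ : AddChar S ℂ}

/-- The exponential sum over the affine quadric `x ⬝ᵥ x + k = 0` with frequency `u`: these are the
Fourier coefficients of the indicator function of the quadric. -/
noncomputable def quadricSum (ψ : AddChar S ℂ) (k : S) (u : ι → S) : ℂ :=
  ∑ x : ι → S with x ⬝ᵥ x + k = 0, ψ (u ⬝ᵥ x)

/-- The exponential sum of `a (x ⬝ᵥ x + k) + u ⬝ᵥ x`; summing it over all `a` detects the quadric
`x ⬝ᵥ x + k = 0`. -/
noncomputable def phaseSum (ψ : AddChar S ℂ) (k : S) (u : ι → S) (a : S) : ℂ :=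
  ∑ x : ι → S, ψ (a * (x ⬝ᵥ x + k) + u ⬝ᵥ x)

/-- The part of the sum detecting the quadric `x ⬝ᵥ x + k = 0` that comes from the units `a`. -/
noncomputable def reducedSum (ψ : AddChar S ℂ) (k : S) (u : ι → S) : ℂ :=
  ∑ a : Sˣ, phaseSum ψ k u a

/-- The part of the sum detecting the quadric `x ⬝ᵥ x + k = 0` that comes from the nonunits `a`. -/
noncomputable def nonreducedSum (ψ : AddChar S ℂ) (k : S) (u : ι → S) : ℂ :=
  open Classical in ∑ a : S with ¬ IsUnit a, phaseSum ψ k u a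

theorem sum_phaseSum (hψ : ψ.IsPrimitive) (k : S) (u : ι → S) :
    ∑ a, phaseSum ψ k u a = Fintype.card S * quadricSum ψ k u := by
  simp only [phaseSum, quadricSum, mul_sum, sum_filter]
  rw [sum_comm]
  refine sum_congr rfl fun x _ => ?_
  simp only [AddChar.map_add_eq_mul ψ _ (u ⬝ᵥ x)]
  rw [← sum_mul, AddChar.sum_mulShift _ hψ]
  split_ifs <;> simp

theorem reducedSum_add_nonreducedSum (hψ : ψ.IsPrimitive) (k : S) (u : ι → S) :
    reducedSum ψ k u + nonreducedSum ψ k u = Fintype.card S * quadricSum ψ k u := by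
  rw [reducedSum, nonreducedSum, sum_units_add_sum_nonunits, sum_phaseSum hψ]

theorem norm_quadricSum_le (k : S) (u : ι → S) :
    ‖quadricSum ψ k u‖ ≤ (Fintype.card S : ℝ) ^ Fintype.card ι := by
  refine (norm_sum_addChar_le _ _).trans ?_
  exact_mod_cast (card_le_univ _).trans_eq Fintype.card_fun

omit [DecidableEq S] in
/-- Translating `x i` by `c` changes the phase only by the constant `u i * c` as soon as
`a * c = 0`. -/
theorem phaseSum_eq_zero (k : S) (u : ι → S) {a c : S} (hac : a * c = 0) {i : ι}
    (hc : ψ (u i * c) ≠ 1) : phaseSum ψ k u a = 0 := by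
  have shift : phaseSum ψ k u a = ψ (u i * c) * phaseSum ψ k u a := by
    conv_lhs => rw [phaseSum, ← Equiv.sum_comp (Equiv.addRight (Pi.single i c))]
    rw [phaseSum, mul_sum]
    refine sum_congr rfl fun x _ => ?_
    rw [← AddChar.map_add_eq_mul]
    congr 1
    simp only [Equiv.coe_addRight, dotProduct_add, add_dotProduct, dotProduct_single,
      single_dotProduct, Pi.single_eq_same, Pi.add_apply]
    linear_combination (2 * x i + c) * hac
  have : (1 - ψ (u i * c)) * phaseSum ψ k u a = 0 := by
    linear_combination shift
  exact (mul_eq_zero.mp this).resolve_left (sub_ne_zero.mpr hc.symm)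

omit [DecidableEq S] in
theorem phaseSum_unit (k : S) (u : ι → S) (a t : Sˣ) (ht : (t : S) = 2) :
    phaseSum ψ k u a = ψ (a * k) *
      (ψ (-((u ⬝ᵥ u) * ((t ^ 2 * a)⁻¹ : Sˣ))) * quadGauss ψ a ^ Fintype.card ι) := by
  rw [← sum_addChar_dotProduct_self_add a t ht, phaseSum, mul_sum]
  simp only [← AddChar.map_add_eq_mul]
  exact sum_congr rfl fun x _ => by ring_nf

omit [DecidableEq S] in
/-- Undoing the completion of the square in one variable cancels the inverse of the multiplier, so
that the sum over all units `b` detects the square roots of `-ν (u ⬝ᵥ u)`. -/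
theorem phaseSum_neg_inv (hsum : ∀ b : Sˣ, ∃ c d : S, (b : S) = c ^ 2 + d ^ 2)
    (hsq : ∀ a b : Sˣ, IsSquare a ∨ IsSquare b ∨ IsSquare (a * b))
    (t ν b : Sˣ) (ht : (t : S) = 2) (v : S) (u : Fin 3 → S) :
    phaseSum ψ (ν * v ^ 2) u ((-(t ^ 2 * ν) * b)⁻¹ : Sˣ) =
      quadGauss ψ 1 * quadGauss ψ (-ν : Sˣ) *
        ∑ x : S, ψ (v * x) * ψ (b * (x ^ 2 + ν * (u ⬝ᵥ u))) := by
  have gauss : quadGauss ψ ((-(t ^ 2 * ν) * b)⁻¹ : Sˣ) = quadGauss ψ ((-ν * b : Sˣ) : S) := by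
    rw [quadGauss_inv, ← quadGauss_mul_sq ((-ν * b : Sˣ) : S) t]
    congr 1
    push_cast
    ring
  have constant : (((-(t ^ 2 * ν) * b)⁻¹ : Sˣ) : S) * (ν * v ^ 2) =
      -(v ^ 2 * ((t ^ 2 * b)⁻¹ : Sˣ)) := by
    simp only [mul_inv, inv_neg, Units.val_mul, Units.val_neg]
    linear_combination (-v ^ 2 * ((t ^ 2)⁻¹ : Sˣ) * (b⁻¹ : Sˣ)) * ν.mul_inv
  have inverse : (t ^ 2 * (-(t ^ 2 * ν) * b)⁻¹)⁻¹ = -(b * ν) := by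
    rw [mul_inv, inv_inv, neg_mul, mul_assoc, mul_neg, inv_mul_cancel_left, mul_comm]
  have complete : ∑ x : S, ψ (v * x) * ψ (b * (x ^ 2 + ν * (u ⬝ᵥ u))) =
      ψ (b * (ν * (u ⬝ᵥ u))) * (ψ (-(v ^ 2 * ((t ^ 2 * b)⁻¹ : Sˣ))) * quadGauss ψ b) := by
    rw [← sum_addChar_sq_add_linear b t ht, mul_sum]
    refine sum_congr rfl fun x _ => ?_
    rw [← AddChar.map_add_eq_mul, ← AddChar.map_add_eq_mul]
    ring_nf
  rw [phaseSum_unit _ _ _ t ht, gauss, Fintype.card_fin, quadGauss_mul_cube hsum hsq, constant,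
    inverse, complete, Units.val_neg, Units.val_mul, mul_neg, neg_neg, mul_comm (u ⬝ᵥ u),
    mul_assoc (b : S)]
  ring

theorem norm_reducedSum_eq (hψ : ψ.IsPrimitive)
    (hsum : ∀ b : Sˣ, ∃ c d : S, (b : S) = c ^ 2 + d ^ 2)
    (hsq : ∀ a b : Sˣ, IsSquare a ∨ IsSquare b ∨ IsSquare (a * b))
    (t ν : Sˣ) (ht : (t : S) = 2) (v : S) (u : Fin 3 → S) :
    ‖reducedSum ψ (ν * v ^ 2) u‖ =
      Fintype.card S * ‖∑ x : S, ψ (v * x) * ∑ b : Sˣ, ψ (b * (x ^ 2 + ν * (u ⬝ᵥ u)))‖ := by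
  have norm_gauss (a : Sˣ) : ‖quadGauss ψ a‖ = √(Fintype.card S) :=
    (Real.sqrt_eq_iff_eq_sq (by positivity) (norm_nonneg _)).mpr
      (norm_quadGauss_sq hψ a t ht).symm |>.symm
  have substitution : reducedSum ψ (ν * v ^ 2) u =
      ∑ b : Sˣ, phaseSum ψ (ν * v ^ 2) u ((-(t ^ 2 * ν) * b)⁻¹ : Sˣ) :=
    (Fintype.sum_equiv ((Equiv.mulLeft (-(t ^ 2 * ν))).trans (Equiv.inv Sˣ)) _ _
      fun _ => rfl).symm
  have norm_gauss_one : ‖quadGauss ψ (1 : S)‖ = √(Fintype.card S) := norm_gauss 1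
  rw [substitution, sum_congr rfl fun b _ => phaseSum_neg_inv hsum hsq t ν b ht v u, ← mul_sum,
    norm_mul, norm_mul, norm_gauss, norm_gauss_one, Real.mul_self_sqrt (by positivity), sum_comm]
  simp only [mul_sum]

end QuadricSums

section PrimePowerResidues

variable {p s : ℕ} [hp : Fact p.Prime]

theorem castHom_eq_zero_iff_dvd (hs : s ≠ 0) (x : ZMod (p ^ s)) :
    ZMod.castHom (dvd_pow_self p hs) (ZMod p) x = 0 ↔ (p : ZMod (p ^ s)) ∣ x := by
  constructor
  · rw [ZMod.castHom_apply, ZMod.cast_eq_val, ZMod.natCast_eq_zero_iff]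
    intro h
    simpa using map_dvd (Nat.castRingHom (ZMod (p ^ s))) h
  · rintro ⟨y, rfl⟩
    rw [map_mul, map_natCast, CharP.cast_eq_zero, zero_mul]

theorem isUnit_iff_castHom_ne_zero (hs : s ≠ 0) (x : ZMod (p ^ s)) :
    IsUnit x ↔ ZMod.castHom (dvd_pow_self p hs) (ZMod p) x ≠ 0 := by
  refine ⟨fun h => (h.map _).ne_zero, fun h => ?_⟩
  rw [ZMod.castHom_apply, ZMod.cast_eq_val, Ne, ZMod.natCast_eq_zero_iff] at h
  rw [← ZMod.natCast_zmod_val x, ZMod.isUnit_iff_coprime]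
  exact ((hp.out.coprime_iff_not_dvd.mpr h).symm).pow_right s

theorem isUnit_iff_not_dvd (hs : s ≠ 0) (x : ZMod (p ^ s)) :
    IsUnit x ↔ ¬ (p : ZMod (p ^ s)) ∣ x := by
  rw [isUnit_iff_castHom_ne_zero hs, Ne, castHom_eq_zero_iff_dvd hs]

theorem isSquare_of_dvd_sub_one (hp2 : p ≠ 2) (hs : s ≠ 0) {y : (ZMod (p ^ s))ˣ}
    (hy : (p : ZMod (p ^ s)) ∣ (y : ZMod (p ^ s)) - 1) : IsSquare y := by
  have order : y ^ p ^ (s - 1) = 1 := by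
    have h := dvd_sub_pow_of_dvd_sub hy (s - 1)
    rw [Nat.sub_add_cancel (Nat.one_le_iff_ne_zero.mpr hs), ← Nat.cast_pow, ZMod.natCast_self,
      zero_dvd_iff, one_pow, sub_eq_zero] at h
    exact Units.ext (by rwa [Units.val_pow_eq_pow_val])
  obtain ⟨m, hm⟩ : Odd (p ^ (s - 1)) := (hp.out.odd_of_ne_two hp2).pow
  refine ⟨y ^ (m + 1), ?_⟩
  rw [← pow_add, show m + 1 + (m + 1) = 2 * m + 1 + 1 by ring, ← hm, pow_succ, order, one_mul]

theorem isSquare_of_isSquare_castHom (hp2 : p ≠ 2) (hs : s ≠ 0) (x : (ZMod (p ^ s))ˣ)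
    (hx : IsSquare (ZMod.castHom (dvd_pow_self p hs) (ZMod p) (x : ZMod (p ^ s)))) :
    IsSquare x := by
  set φ := ZMod.castHom (dvd_pow_self p hs) (ZMod p)
  have unit_ne_zero (y : (ZMod (p ^ s))ˣ) : φ y ≠ 0 :=
    (isUnit_iff_castHom_ne_zero hs _).mp y.isUnit
  obtain ⟨c, hc⟩ := hx
  obtain ⟨d, rfl⟩ := ZMod.castHom_surjective (dvd_pow_self p hs) c
  obtain ⟨e, rfl⟩ : IsUnit d := (isUnit_iff_castHom_ne_zero hs d).mpr fun h =>
    unit_ne_zero x (by rw [hc, h, mul_zero])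
  have quotient : IsSquare (x * (e * e)⁻¹) := by
    refine isSquare_of_dvd_sub_one hp2 hs ((castHom_eq_zero_iff_dvd hs _).mp ?_)
    have h : φ (x * (e * e)⁻¹ : (ZMod (p ^ s))ˣ) * φ (e * e : (ZMod (p ^ s))ˣ) =
        1 * φ (e * e : (ZMod (p ^ s))ˣ) := by
      rw [← map_mul, ← Units.val_mul, inv_mul_cancel_right, hc, one_mul, Units.val_mul, map_mul]
    rw [map_sub, map_one, mul_right_cancel₀ (unit_ne_zero _) h, sub_self]
  rw [← inv_mul_cancel_right x (e * e)]
  exact quotient.mul (IsSquare.mul_self e)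

theorem exists_eq_sq_add_sq (hp2 : p ≠ 2) (hs : s ≠ 0) (b : (ZMod (p ^ s))ˣ) :
    ∃ c d : ZMod (p ^ s), (b : ZMod (p ^ s)) = c ^ 2 + d ^ 2 := by
  set φ := ZMod.castHom (dvd_pow_self p hs) (ZMod p) with hφ
  have lift (c d : ZMod p) (hc : c ≠ 0) (h : c ^ 2 + d ^ 2 = φ b) :
      ∃ c d : ZMod (p ^ s), (b : ZMod (p ^ s)) = c ^ 2 + d ^ 2 := by
    obtain ⟨d', rfl⟩ := ZMod.castHom_surjective (dvd_pow_self p hs) d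
    have hφc : φ ((b : ZMod (p ^ s)) - d' ^ 2) = c ^ 2 := by
      rw [map_sub, map_pow, ← h, add_sub_cancel_right]
    obtain ⟨e, he⟩ : IsUnit ((b : ZMod (p ^ s)) - d' ^ 2) := by
      rw [isUnit_iff_castHom_ne_zero hs, ← hφ, hφc]
      exact pow_ne_zero 2 hc
    obtain ⟨f, rfl⟩ : IsSquare e := by
      refine isSquare_of_isSquare_castHom hp2 hs e ?_
      rw [he, ← hφ, hφc]
      exact IsSquare.sq c
    exact ⟨f, d', by rw [← sub_eq_iff_eq_add, ← he, Units.val_mul, sq]⟩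
  obtain ⟨c, d, h⟩ := ZMod.sq_add_sq p (φ b)
  by_cases hc : c = 0
  · have hd : d ≠ 0 := by
      rintro rfl
      exact (isUnit_iff_castHom_ne_zero hs _).mp b.isUnit (by rw [← hφ, ← h, hc]; ring)
    exact lift d c hd (by rw [← h, add_comm])
  · exact lift c d hc h

theorem isSquare_or_isSquare_or_isSquare_mul (hp2 : p ≠ 2) (hs : s ≠ 0) (a b : (ZMod (p ^ s))ˣ) :
    IsSquare a ∨ IsSquare b ∨ IsSquare (a * b) := by
  have ha := (isUnit_iff_castHom_ne_zero hs _).mp a.isUnit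
  have hb := (isUnit_iff_castHom_ne_zero hs _).mp b.isUnit
  have lift (x : (ZMod (p ^ s))ˣ) := isSquare_of_isSquare_castHom hp2 hs x
  rcases ZMod.pow_div_two_eq_neg_one_or_one p ha with h1 | h1
  · exact Or.inl (lift a ((ZMod.euler_criterion p ha).mpr h1))
  rcases ZMod.pow_div_two_eq_neg_one_or_one p hb with h2 | h2
  · exact Or.inr (Or.inl (lift b ((ZMod.euler_criterion p hb).mpr h2)))
  refine Or.inr (Or.inr (lift _ ?_))
  rw [Units.val_mul, map_mul, ZMod.euler_criterion p (mul_ne_zero ha hb), mul_pow, h1, h2]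
  ring

end PrimePowerResidues

section SquareRoots

variable {p m s : ℕ} [hp : Fact p.Prime]

theorem castHom_eq_intCast_iff (hms : m ≤ s) (x : ZMod (p ^ s)) (c : ℤ) :
    ZMod.castHom (pow_dvd_pow p hms) (ZMod (p ^ m)) x = c ↔ (p : ℤ) ^ m ∣ x.val - c := by
  rw [ZMod.castHom_apply, ZMod.cast_eq_val, ← Int.cast_natCast, eq_comm,
    ZMod.intCast_eq_intCast_iff_dvd_sub, Nat.cast_pow]

theorem card_pow_dvd_val_sub (hms : m ≤ s) (c : ℤ) :
    #{x : ZMod (p ^ s) | (p : ℤ) ^ m ∣ x.val - c} = p ^ (s - m) := by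
  simp only [← castHom_eq_intCast_iff hms]
  have h := card_smul_sum_comp_of_surjective
    (φ := (ZMod.castHom (pow_dvd_pow p hms) (ZMod (p ^ m))).toAddMonoidHom)
    (ZMod.castHom_surjective (pow_dvd_pow p hms))
    fun y => if y = (c : ZMod (p ^ m)) then (1 : ℕ) else 0
  simp only [RingHom.toAddMonoidHom_eq_coe, AddMonoidHom.coe_coe, sum_boole, ZMod.card,
    smul_eq_mul, Nat.cast_id, filter_eq', mem_univ, if_true, card_singleton, mul_one] at h
  refine Nat.eq_of_mul_eq_mul_left (pow_pos hp.out.pos m) ?_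
  rw [h, ← pow_add, Nat.add_sub_cancel' hms]

theorem pow_dvd_of_pow_dvd_mul {A B : ℤ} {l : ℕ} (h : (p : ℤ) ^ m ∣ A * B)
    (hA : ¬ (p : ℤ) ^ (m - l) ∣ A) : (p : ℤ) ^ (l + 1) ∣ B := by
  have hpZ : Prime (p : ℤ) := Nat.prime_iff_prime_int.mp hp.out
  have hA0 : A ≠ 0 := by
    rintro rfl
    exact hA (dvd_zero _)
  obtain ⟨α, A', hA', rfl⟩ := WfDvdMonoid.max_power_factor hA0 hpZ.irreducible
  have hα : α < m - l := by
    by_contra hcon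
    exact hA ((pow_dvd_pow _ (not_lt.mp hcon)).mul_right _)
  rw [← Nat.add_sub_cancel' (by omega : α ≤ m), pow_add, mul_assoc,
    mul_dvd_mul_iff_left (pow_ne_zero _ hpZ.ne_zero)] at h
  exact (pow_dvd_pow _ (by omega)).trans (hpZ.pow_dvd_of_dvd_mul_left (m - α) hA' h)

theorem card_sq_roots_le_of_dvd (hms : m ≤ s) {y : ℤ} (hy : (p : ℤ) ^ m ∣ y) :
    #{x : ZMod (p ^ s) | (p : ℤ) ^ m ∣ (x.val : ℤ) ^ 2 - y} ≤ p ^ (s - m + m / 2) := by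
  rw [show s - m + m / 2 = s - (m - m / 2) by omega,
    ← card_pow_dvd_val_sub (by omega : m - m / 2 ≤ s) 0]
  refine card_le_card fun x hx => ?_
  simp only [mem_filter, mem_univ, true_and, sub_zero] at hx ⊢
  by_contra hcon
  have hxx : (p : ℤ) ^ m ∣ x.val * x.val := by
    rw [← sq]
    exact (dvd_sub_left hy).mp hx
  exact hcon ((pow_dvd_pow _ (by omega)).trans (pow_dvd_of_pow_dvd_mul hxx hcon))

theorem card_sq_roots_le_of_root (hp2 : p ≠ 2) (hms : m ≤ s) {y x₀ : ℤ} {l : ℕ} (hl : l ≤ m)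
    (hroot : (p : ℤ) ^ m ∣ x₀ ^ 2 - y) (hx₀ : ¬ (p : ℤ) ^ (l + 1) ∣ x₀) :
    #{x : ZMod (p ^ s) | (p : ℤ) ^ m ∣ (x.val : ℤ) ^ 2 - y} ≤ 2 * p ^ (s - m + l) := by
  have cover : ({x | (p : ℤ) ^ m ∣ (x.val : ℤ) ^ 2 - y} : Finset (ZMod (p ^ s))) ⊆
      ({x | (p : ℤ) ^ (m - l) ∣ x.val - x₀} : Finset (ZMod (p ^ s))) ∪
        ({x | (p : ℤ) ^ (m - l) ∣ x.val - -x₀} : Finset (ZMod (p ^ s))) := by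
    intro x hx
    simp only [mem_filter, mem_univ, true_and, mem_union] at hx ⊢
    by_contra! hcon
    have factored : (p : ℤ) ^ m ∣ (x.val - x₀) * (x.val - -x₀) := by
      rw [show ((x.val : ℤ) - x₀) * (x.val - -x₀) = (x.val ^ 2 - y) - (x₀ ^ 2 - y) by ring]
      exact dvd_sub hx hroot
    have hdouble := dvd_sub (pow_dvd_of_pow_dvd_mul factored hcon.1)
      (pow_dvd_of_pow_dvd_mul (mul_comm (_ : ℤ) _ ▸ factored) hcon.2)
    rw [show ((x.val : ℤ) - -x₀) - (x.val - x₀) = 2 * x₀ by ring] at hdouble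
    refine hx₀ ((Nat.prime_iff_prime_int.mp hp.out).pow_dvd_of_dvd_mul_left _ (fun h2 => ?_)
      hdouble)
    exact hp2 ((Nat.prime_dvd_prime_iff_eq hp.out Nat.prime_two).mp (by exact_mod_cast h2))
  refine (card_le_card cover).trans ((card_union_le _ _).trans (le_of_eq ?_))
  rw [card_pow_dvd_val_sub (by omega), card_pow_dvd_val_sub (by omega), ← two_mul,
    show s - (m - l) = s - m + l by omega]

theorem exists_card_sq_roots_le (hp2 : p ≠ 2) (hms : m ≤ s) (y : ℤ) :
    ∃ l, 2 * l ≤ m ∧ (p : ℤ) ^ (2 * l) ∣ y ∧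
      #{x : ZMod (p ^ s) | (p : ℤ) ^ m ∣ (x.val : ℤ) ^ 2 - y} ≤ 2 * p ^ (s - m + l) := by
  by_cases hy : (p : ℤ) ^ m ∣ y
  · refine ⟨m / 2, Nat.mul_div_le m 2, (pow_dvd_pow _ (Nat.mul_div_le m 2)).trans hy, ?_⟩
    exact (card_sq_roots_le_of_dvd hms hy).trans (Nat.le_mul_of_pos_left _ two_pos)
  by_cases hex : ∃ x₀ : ℤ, (p : ℤ) ^ m ∣ x₀ ^ 2 - y
  swap
  · refine ⟨0, by omega, by simp, ?_⟩
    rw [filter_false_of_mem fun x _ h => hex ⟨_, h⟩]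
    simp
  obtain ⟨x₀, hroot⟩ := hex
  have dvd_sq_iff {e : ℕ} (he : e ≤ m) : (p : ℤ) ^ e ∣ x₀ ^ 2 ↔ (p : ℤ) ^ e ∣ y :=
    dvd_iff_dvd_of_dvd_sub ((pow_dvd_pow _ he).trans hroot)
  have hx₀ : x₀ ≠ 0 := by
    rintro rfl
    exact hy ((dvd_sq_iff le_rfl).mp (by simp))
  have hpZ : Prime (p : ℤ) := Nat.prime_iff_prime_int.mp hp.out
  obtain ⟨l, z, hz, rfl⟩ := WfDvdMonoid.max_power_factor hx₀ hpZ.irreducible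
  have hsq : (p : ℤ) ^ (2 * l) ∣ (p ^ l * z) ^ 2 := by
    rw [mul_pow, ← pow_mul, mul_comm l 2]
    exact dvd_mul_right _ _
  have hlm : 2 * l < m := by
    by_contra! hcon
    exact hy ((dvd_sq_iff le_rfl).mp ((pow_dvd_pow _ hcon).trans hsq))
  refine ⟨l, hlm.le, (dvd_sq_iff hlm.le).mp hsq,
    card_sq_roots_le_of_root hp2 hms (by omega) hroot ?_⟩
  rwa [pow_succ, mul_dvd_mul_iff_left (pow_ne_zero _ hpZ.ne_zero)]

end SquareRoots

theorem stdAddChar_mul_of_eq {N a b : ℕ} [NeZero N] [NeZero b] (h : N = a * b) (m : ℤ) :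
    ZMod.stdAddChar ((a * m : ℤ) : ZMod N) = ZMod.stdAddChar (m : ZMod b) := by
  have ha : (a : ℂ) ≠ 0 := by
    exact_mod_cast left_ne_zero_of_mul (h ▸ NeZero.ne N)
  have hb : (b : ℂ) ≠ 0 := by exact_mod_cast NeZero.ne b
  rw [ZMod.stdAddChar_coe, ZMod.stdAddChar_coe, h]
  congr 1
  push_cast
  field_simp

section PrimePowerRecursion

variable {p s : ℕ} [hp : Fact p.Prime]

theorem stdAddChar_prime_mul_val_mul (c : ZMod (p ^ s)) (y : ZMod (p ^ (s + 1))) :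
    ZMod.stdAddChar (((p * c.val : ℕ) : ZMod (p ^ (s + 1))) * y) =
      ZMod.stdAddChar (c * ZMod.castHom (pow_dvd_pow p s.le_succ) (ZMod (p ^ s)) y) := by
  obtain ⟨m, rfl⟩ := ZMod.intCast_surjective y
  have h := stdAddChar_mul_of_eq (pow_succ' p s) (c.val * m)
  push_cast at h ⊢
  rw [mul_assoc, h, ZMod.natCast_zmod_val, map_intCast]

theorem sum_nonunits_eq [DecidablePred fun a : ZMod (p ^ (s + 1)) => ¬ IsUnit a]
    (F : ZMod (p ^ (s + 1)) → ℂ) :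
    ∑ a with ¬ IsUnit a, F a = ∑ c : ZMod (p ^ s), F (p * c.val : ℕ) := by
  symm
  refine sum_nbij (fun c => ((p * c.val : ℕ) : ZMod (p ^ (s + 1)))) (fun c _ => ?_)
    (fun c _ c' _ h => ?_) (fun a ha => ?_) fun _ _ => rfl
  · simp only [mem_filter, mem_univ, true_and, isUnit_iff_not_dvd s.succ_ne_zero, not_not,
      Nat.cast_mul, dvd_mul_right]
  · rw [ZMod.natCast_eq_natCast_iff, pow_succ'] at h
    have h' := Nat.ModEq.mul_left_cancel' hp.out.ne_zero h
    simpa only [← ZMod.natCast_eq_natCast_iff, ZMod.natCast_zmod_val] using h'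
  · simp only [coe_filter, mem_univ, true_and, Set.mem_ofPred_eq,
      isUnit_iff_not_dvd s.succ_ne_zero, not_not] at ha
    obtain ⟨b, rfl⟩ := ha
    obtain ⟨n, rfl⟩ := ZMod.natCast_zmod_surjective b
    refine ⟨(n : ZMod (p ^ s)), by simp, ?_⟩
    simp only
    rw [← Nat.cast_mul, ZMod.natCast_eq_natCast_iff, pow_succ']
    exact Nat.ModEq.mul_left' p ((ZMod.natCast_eq_natCast_iff _ _ _).mp (by simp))

theorem norm_sum_units_le (z : ZMod (p ^ (s + 1))) :
    ‖∑ b : (ZMod (p ^ (s + 1)))ˣ, ZMod.stdAddChar ((b : ZMod (p ^ (s + 1))) * z)‖ ≤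
      (if z = 0 then (p : ℝ) ^ (s + 1) else 0) +
        if ZMod.castHom (pow_dvd_pow p s.le_succ) (ZMod (p ^ s)) z = 0 then (p : ℝ) ^ s else 0 := by
  classical
  have split := sum_units_add_sum_nonunits
    fun a : ZMod (p ^ (s + 1)) => (ZMod.stdAddChar (a * z) : ℂ)
  rw [sum_nonunits_eq] at split
  simp only [stdAddChar_prime_mul_val_mul] at split
  rw [AddChar.sum_mulShift _ (ZMod.isPrimitive_stdAddChar _),
    AddChar.sum_mulShift _ (ZMod.isPrimitive_stdAddChar _), ZMod.card, ZMod.card] at split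
  rw [eq_sub_of_add_eq split]
  refine (norm_sub_le _ _).trans (add_le_add ?_ ?_) <;> split_ifs <;> simp

theorem phaseSum_prime_mul {ι : Type*} [Fintype ι] [DecidableEq ι] (k : ℤ) (u : ι → ℤ)
    (c : ZMod (p ^ s)) :
    phaseSum ZMod.stdAddChar (k : ZMod (p ^ (s + 1))) (fun i => ((p * u i : ℤ) : ZMod _))
        ((p * c.val : ℕ) : ZMod _) =
      (p : ℂ) ^ Fintype.card ι *
        phaseSum ZMod.stdAddChar (k : ZMod (p ^ s)) (fun i => (u i : ZMod _)) c := by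
  classical
  set φ := ZMod.castHom (pow_dvd_pow p s.le_succ) (ZMod (p ^ s))
  have hφ : Function.Surjective φ := ZMod.castHom_surjective _
  have term (x : ι → ZMod (p ^ (s + 1))) :
      ZMod.stdAddChar (((p * c.val : ℕ) : ZMod (p ^ (s + 1))) * (x ⬝ᵥ x + (k : ZMod _)) +
        (fun i => ((p * u i : ℤ) : ZMod _)) ⬝ᵥ x) =
      ZMod.stdAddChar (c * ((φ ∘ x) ⬝ᵥ (φ ∘ x) + (k : ZMod _)) +
        (fun i => (u i : ZMod _)) ⬝ᵥ (φ ∘ x)) := by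
    obtain ⟨y, rfl⟩ := ZMod.intCast_surjective.comp_left x
    have h := stdAddChar_mul_of_eq (pow_succ' p s) (c.val * (y ⬝ᵥ y + k) + u ⬝ᵥ y)
    simp only [dotProduct, Function.comp_apply, map_intCast] at h ⊢
    push_cast at h ⊢
    rw [ZMod.natCast_zmod_val] at h
    rw [← h]
    simp only [mul_add, mul_sum, mul_assoc]
  have average := card_smul_sum_comp_of_surjective (φ := φ.toAddMonoidHom.compLeft ι)
    hφ.comp_left
    fun y => ZMod.stdAddChar (c * (y ⬝ᵥ y + (k : ZMod _)) + (fun i => (u i : ZMod _)) ⬝ᵥ y)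
  simp only [nsmul_eq_mul, Fintype.card_fun, ZMod.card, Nat.cast_pow, Nat.cast_mul, pow_succ,
    mul_pow] at average
  rw [mul_assoc] at average
  rw [phaseSum, phaseSum, sum_congr rfl fun x _ => term x]
  have hp0 : (p : ℂ) ≠ 0 := by exact_mod_cast hp.out.ne_zero
  exact mul_left_cancel₀ (pow_ne_zero _ (pow_ne_zero _ hp0)) average

theorem nonreducedSum_prime_mul {ι : Type*} [Fintype ι] [DecidableEq ι] (k : ℤ) (u : ι → ℤ) :
    nonreducedSum ZMod.stdAddChar (k : ZMod (p ^ (s + 1))) (fun i => ((p * u i : ℤ) : ZMod _)) =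
      (p : ℂ) ^ Fintype.card ι * ((p : ℂ) ^ s *
        quadricSum ZMod.stdAddChar (k : ZMod (p ^ s)) fun i => (u i : ZMod _)) := by
  rw [nonreducedSum, sum_nonunits_eq, sum_congr rfl fun c _ => phaseSum_prime_mul k u c, ← mul_sum,
    sum_phaseSum (ZMod.isPrimitive_stdAddChar _), ZMod.card, Nat.cast_pow]

theorem nonreducedSum_eq_zero {ι : Type*} [Fintype ι] [DecidableEq ι] (k : ZMod (p ^ (s + 1)))
    {u : ι → ℤ} {i : ι} (hi : ¬ (p : ℤ) ∣ u i) :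
    nonreducedSum ZMod.stdAddChar k (fun i => (u i : ZMod (p ^ (s + 1)))) = 0 := by
  classical
  rw [nonreducedSum, sum_nonunits_eq]
  refine sum_eq_zero fun c _ => phaseSum_eq_zero _ _ (c := (p ^ s : ℕ)) (i := i) ?_ fun h => hi ?_
  · rw [← Nat.cast_mul, mul_right_comm, ← pow_succ', Nat.cast_mul, ZMod.natCast_self, zero_mul]
  · rw [← AddChar.map_zero_eq_one (ZMod.stdAddChar (N := p ^ (s + 1)))] at h
    have h' := ZMod.injective_stdAddChar h
    rw [← Int.cast_natCast, ← Int.cast_mul, ZMod.intCast_zmod_eq_zero_iff_dvd, Nat.cast_pow,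
      Nat.cast_pow, pow_succ',
      mul_dvd_mul_iff_right (pow_ne_zero _ (by exact_mod_cast hp.out.ne_zero))] at h'
    exact h'

end PrimePowerRecursion

/-- The integer vector `u` resonates with `j` and `g` if `j` divides every `u i` and `j ^ 2 * g`
divides `u ⬝ᵥ u`. The exponential sums over the quadrics `x ⬝ᵥ x + k = 0` modulo `q` are large only
at frequencies that resonate with some `j * g ∣ q`. -/
def IsResonant {ι : Type*} [Fintype ι] (j g : ℕ) (u : ι → ℤ) : Prop :=
  (∀ i, (j : ℤ) ∣ u i) ∧ (j : ℤ) ^ 2 * g ∣ u ⬝ᵥ u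

theorem isResonant_one_iff {ι : Type*} [Fintype ι] {g : ℕ} {u : ι → ℤ} :
    IsResonant 1 g u ↔ (g : ℤ) ∣ u ⬝ᵥ u := by
  simp [IsResonant]

theorem IsResonant.smul {ι : Type*} [Fintype ι] {j g : ℕ} {u : ι → ℤ} (h : IsResonant j g u)
    (p : ℕ) : IsResonant (p * j) g fun i => p * u i := by
  refine ⟨fun i => by exact_mod_cast mul_dvd_mul_left _ (h.1 i), ?_⟩
  have hsq : (fun i => (p : ℤ) * u i) ⬝ᵥ (fun i => (p : ℤ) * u i) = (p : ℤ) ^ 2 * (u ⬝ᵥ u) := by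
    simp only [dotProduct, mul_sum]
    exact sum_congr rfl fun i _ => by ring
  rw [hsq, Nat.cast_mul, mul_pow, mul_assoc]
  exact mul_dvd_mul_left _ h.2

/-- The quadric sums modulo `q` in three variables are at most `K * q` times the size `j * √g` of
some resonance `j * g ∣ q` of the frequency. -/
def QuadricSumBound (q : ℕ) [NeZero q] (k : ℤ) (K : ℝ) : Prop :=
  ∀ u : Fin 3 → ℤ, ∃ j g : ℕ, j * g ∣ q ∧ IsResonant j g u ∧
    ‖quadricSum ZMod.stdAddChar (k : ZMod q) fun i => (u i : ZMod q)‖ ≤ K * q * (j * √g)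

theorem quadricSumBound_sq (q : ℕ) [NeZero q] (k : ℤ) : QuadricSumBound q k ((q : ℝ) ^ 2) := by
  refine fun u => ⟨1, 1, one_dvd q, isResonant_one_iff.mpr (by simp), ?_⟩
  refine (norm_quadricSum_le _ _).trans_eq ?_
  rw [ZMod.card, Fintype.card_fin, Nat.cast_one, Real.sqrt_one]
  ring

theorem QuadricSumBound.mono {q : ℕ} [NeZero q] {k : ℤ} {K K' : ℝ} (h : QuadricSumBound q k K)
    (hK : K ≤ K') : QuadricSumBound q k K' := by
  intro u
  obtain ⟨j, g, hjg, hres, hle⟩ := h u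
  exact ⟨j, g, hjg, hres, hle.trans (by gcongr)⟩

section PrimePowerBound

variable {p s : ℕ} [hp : Fact p.Prime]

theorem map_sq_sub_eq_zero_iff {N M : ℕ} [NeZero N] (f : ZMod N →+* ZMod M) (x : ZMod N) (y : ℤ) :
    f (x ^ 2 - y) = 0 ↔ (M : ℤ) ∣ (x.val : ℤ) ^ 2 - y := by
  have lift : x ^ 2 - y = (((x.val : ℤ) ^ 2 - y : ℤ) : ZMod N) := by
    push_cast
    rw [ZMod.natCast_zmod_val]
  rw [lift, map_intCast, ZMod.intCast_zmod_eq_zero_iff_dvd]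

theorem sum_norm_sum_units_le (hp2 : p ≠ 2) (y : ℤ) :
    ∃ l, 2 * l ≤ s + 1 ∧ (p : ℤ) ^ (2 * l) ∣ y ∧
      ∑ x : ZMod (p ^ (s + 1)), ‖∑ b : (ZMod (p ^ (s + 1)))ˣ,
        ZMod.stdAddChar ((b : ZMod (p ^ (s + 1))) * (x ^ 2 - (y : ZMod _)))‖ ≤
          4 * (p : ℝ) ^ (s + 1) * p ^ l := by
  obtain ⟨l₁, hl₁, hdvd₁, hcard₁⟩ := exists_card_sq_roots_le (p := p) hp2 (le_refl (s + 1)) y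
  obtain ⟨l₂, hl₂, hdvd₂, hcard₂⟩ := exists_card_sq_roots_le (p := p) hp2 s.le_succ y
  refine ⟨max l₁ l₂, by omega, ?_, ?_⟩
  · rcases max_choice l₁ l₂ with h | h <;> rw [h] <;> assumption
  have hone : (1 : ℝ) ≤ p := by exact_mod_cast hp.out.one_lt.le
  rw [Nat.sub_self, zero_add] at hcard₁
  rw [show s + 1 - s = 1 by omega] at hcard₂
  have zero_iff₁ (x : ZMod (p ^ (s + 1))) :
      x ^ 2 - y = 0 ↔ (p : ℤ) ^ (s + 1) ∣ (x.val : ℤ) ^ 2 - y := by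
    exact_mod_cast map_sq_sub_eq_zero_iff (RingHom.id _) x y
  have zero_iff₂ (x : ZMod (p ^ (s + 1))) :
      ZMod.castHom (pow_dvd_pow p s.le_succ) (ZMod (p ^ s)) (x ^ 2 - y) = 0 ↔
        (p : ℤ) ^ s ∣ (x.val : ℤ) ^ 2 - y := by
    exact_mod_cast map_sq_sub_eq_zero_iff _ x y
  calc ∑ x : ZMod (p ^ (s + 1)), ‖∑ b : (ZMod (p ^ (s + 1)))ˣ,
        ZMod.stdAddChar ((b : ZMod (p ^ (s + 1))) * (x ^ 2 - (y : ZMod _)))‖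
      ≤ #{x : ZMod (p ^ (s + 1)) | (p : ℤ) ^ (s + 1) ∣ (x.val : ℤ) ^ 2 - y} * (p : ℝ) ^ (s + 1) +
        #{x : ZMod (p ^ (s + 1)) | (p : ℤ) ^ s ∣ (x.val : ℤ) ^ 2 - y} * (p : ℝ) ^ s := by
        refine (sum_le_sum fun x _ => norm_sum_units_le _).trans_eq ?_
        simp only [sum_add_distrib, ← sum_filter, sum_const, nsmul_eq_mul, zero_iff₁, zero_iff₂]
    _ ≤ (2 * (p : ℝ) ^ l₁) * (p : ℝ) ^ (s + 1) + (2 * (p : ℝ) ^ (1 + l₂)) * (p : ℝ) ^ s := by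
        gcongr <;> assumption_mod_cast
    _ = 2 * (p : ℝ) ^ (s + 1) * p ^ l₁ + 2 * (p : ℝ) ^ (s + 1) * p ^ l₂ := by ring
    _ ≤ 2 * (p : ℝ) ^ (s + 1) * p ^ max l₁ l₂ + 2 * (p : ℝ) ^ (s + 1) * p ^ max l₁ l₂ := by
        gcongr <;> simp
    _ = 4 * (p : ℝ) ^ (s + 1) * p ^ max l₁ l₂ := by ring

theorem isUnit_intCast_of_not_dvd {m : ℤ} (hm : ¬ (p : ℤ) ∣ m) :
    IsUnit (m : ZMod (p ^ (s + 1))) := by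
  rwa [isUnit_iff_castHom_ne_zero s.succ_ne_zero, map_intCast, Ne,
    ZMod.intCast_zmod_eq_zero_iff_dvd]

/-- Writing the constant term as `ν * e ^ 2` with `p ∤ ν` covers `k = 0` as well as `p ∤ k`. -/
theorem norm_reducedSum_le (hp2 : p ≠ 2) {ν : ℤ} (hν : ¬ (p : ℤ) ∣ ν) (e : ℤ) (u : Fin 3 → ℤ) :
    ∃ l, 2 * l ≤ s + 1 ∧ (p : ℤ) ^ (2 * l) ∣ u ⬝ᵥ u ∧
      ‖reducedSum ZMod.stdAddChar ((ν * e ^ 2 : ℤ) : ZMod (p ^ (s + 1))) fun i => (u i : ZMod _)‖ ≤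
        (p : ℝ) ^ (s + 1) * (4 * (p : ℝ) ^ (s + 1) * p ^ l) := by
  obtain ⟨ν', hν'⟩ := isUnit_intCast_of_not_dvd (s := s) hν
  have two_not_dvd : ¬ (p : ℤ) ∣ 2 := fun h =>
    hp2 ((Nat.prime_dvd_prime_iff_eq hp.out Nat.prime_two).mp (by exact_mod_cast h))
  obtain ⟨t, ht⟩ := isUnit_intCast_of_not_dvd (s := s) two_not_dvd
  rw [Int.cast_ofNat] at ht
  obtain ⟨l, hl, hdvd, hle⟩ := sum_norm_sum_units_le (p := p) (s := s) hp2 (-(ν * (u ⬝ᵥ u)))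
  refine ⟨l, hl, ?_, ?_⟩
  · exact (Nat.prime_iff_prime_int.mp hp.out).pow_dvd_of_dvd_mul_left _ hν (dvd_neg.mp hdvd)
  have cast_norm : (ν * (u ⬝ᵥ u) : ℤ) =
      (ν' : ZMod (p ^ (s + 1))) * ((fun i => (u i : ZMod (p ^ (s + 1)))) ⬝ᵥ fun i => ↑(u i)) := by
    simp [hν', dotProduct]
  rw [Int.cast_mul, Int.cast_pow, ← hν', norm_reducedSum_eq (ZMod.isPrimitive_stdAddChar _)
    (exists_eq_sq_add_sq hp2 s.succ_ne_zero)
    (isSquare_or_isSquare_or_isSquare_mul hp2 s.succ_ne_zero) t ν' ht, ZMod.card, Nat.cast_pow]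
  refine mul_le_mul_of_nonneg_left ((norm_sum_le_of_le _ fun x _ => ?_).trans hle) (by positivity)
  rw [norm_mul, AddChar.norm_apply, one_mul, Int.cast_neg, cast_norm, sub_neg_eq_add]

theorem exists_norm_quadricSum_prime_pow_le (hp2 : p ≠ 2) {ν : ℤ} (hν : ¬ (p : ℤ) ∣ ν) (e : ℤ)
    (u : Fin 3 → ℤ) :
    ∃ g : ℕ, g ∣ p ^ (s + 1) ∧ IsResonant 1 g u ∧
      (p : ℝ) ^ (s + 1) *
          ‖quadricSum ZMod.stdAddChar ((ν * e ^ 2 : ℤ) : ZMod (p ^ (s + 1))) fun i => ↑(u i)‖ ≤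
        (p : ℝ) ^ (s + 1) * (4 * (p : ℝ) ^ (s + 1) * √g) +
          ‖nonreducedSum ZMod.stdAddChar ((ν * e ^ 2 : ℤ) : ZMod (p ^ (s + 1)))
            fun i => ↑(u i)‖ := by
  obtain ⟨l, hl, hdvd, hred⟩ := norm_reducedSum_le (s := s) hp2 hν e u
  refine ⟨p ^ (2 * l), pow_dvd_pow p hl, isResonant_one_iff.mpr (by exact_mod_cast hdvd), ?_⟩
  have split := reducedSum_add_nonreducedSum (ZMod.isPrimitive_stdAddChar (p ^ (s + 1)))
    ((ν * e ^ 2 : ℤ) : ZMod (p ^ (s + 1))) fun i => (u i : ZMod _)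
  have hcard : ‖(Fintype.card (ZMod (p ^ (s + 1))) : ℂ)‖ = (p : ℝ) ^ (s + 1) := by
    rw [ZMod.card, Complex.norm_natCast, Nat.cast_pow]
  have hsqrt : √((p ^ (2 * l) : ℕ) : ℝ) = (p : ℝ) ^ l := by
    rw [Nat.cast_pow, pow_mul', Real.sqrt_sq (by positivity)]
  rw [hsqrt, ← hcard, ← norm_mul, ← split, hcard]
  exact (norm_add_le _ _).trans (by gcongr)

theorem QuadricSumBound.prime_pow_succ (hp2 : p ≠ 2) {ν : ℤ} (hν : ¬ (p : ℤ) ∣ ν) {e : ℤ} {K : ℝ}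
    (hK : 0 ≤ K) (h : QuadricSumBound (p ^ s) (ν * e ^ 2) K) :
    QuadricSumBound (p ^ (s + 1)) (ν * e ^ 2) (K + 4) := by
  intro u
  have hps : (0 : ℝ) < (p : ℝ) ^ (s + 1) := pow_pos (by exact_mod_cast hp.out.pos) _
  obtain ⟨g, hg, hres, hle⟩ := exists_norm_quadricSum_prime_pow_le (s := s) hp2 hν e u
  by_cases hall : ∀ i, (p : ℤ) ∣ u i
  · choose w hw using hall
    obtain rfl : u = fun i => p * w i := funext hw
    obtain ⟨j', g', hjg', hres', hle'⟩ := h w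
    rw [nonreducedSum_prime_mul, norm_mul, norm_mul, norm_pow, norm_pow, Complex.norm_natCast,
      Fintype.card_fin] at hle
    have total := hle.trans (add_le_add_right (mul_le_mul_of_nonneg_left
      (mul_le_mul_of_nonneg_left hle' (by positivity)) (by positivity)) _)
    rcases le_total (√g) (p * j' * √g') with hmax | hmax
    · refine ⟨p * j', g', ?_, hres'.smul p, le_of_mul_le_mul_left ?_ hps⟩
      · rw [mul_assoc, pow_succ']
        exact mul_dvd_mul_left p hjg'
      · grw [hmax] at total
        refine total.trans_eq ?_
        push_cast
        ring
    · refine ⟨1, g, by rwa [one_mul], hres, le_of_mul_le_mul_left ?_ hps⟩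
      calc _ ≤ _ := total
        _ = p ^ (s + 1) * (4 * p ^ (s + 1) * √g) +
            p ^ (s + 1) * (K * p ^ (s + 1) * (p * j' * √g')) := by push_cast; ring
        _ ≤ p ^ (s + 1) * (4 * p ^ (s + 1) * √g) + p ^ (s + 1) * (K * p ^ (s + 1) * √g) := by
            gcongr
        _ = _ := by push_cast; ring
  · obtain ⟨i, hi⟩ := not_forall.mp hall
    refine ⟨1, g, by rwa [one_mul], hres, le_of_mul_le_mul_left (hle.trans ?_) hps⟩
    rw [nonreducedSum_eq_zero _ hi, norm_zero, add_zero, Nat.cast_pow, Nat.cast_one, one_mul]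
    gcongr
    linarith

theorem quadricSumBound_prime_pow (hp2 : p ≠ 2) {ν : ℤ} (hν : ¬ (p : ℤ) ∣ ν) (e : ℤ) (s : ℕ) :
    QuadricSumBound (p ^ s) (ν * e ^ 2) (4 * s + 1) := by
  induction s with
  | zero => exact (quadricSumBound_sq _ _).mono (by simp)
  | succ s ih => exact (ih.prime_pow_succ hp2 hν (by positivity)).mono (by push_cast; linarith)

end PrimePowerBound

section CoprimeModuli

variable {ι : Type*} [Fintype ι]

theorem stdAddChar_mul_modulus {m n : ℕ} [NeZero m] [NeZero n] [NeZero (m * n)] {α β : ℤ}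
    (h : α * m + β * n = 1) (x : ℤ) :
    ZMod.stdAddChar (x : ZMod (m * n)) =
      ZMod.stdAddChar ((β * x : ℤ) : ZMod m) * ZMod.stdAddChar ((α * x : ℤ) : ZMod n) := by
  have hm : (m : ℂ) ≠ 0 := by exact_mod_cast NeZero.ne m
  have hn : (n : ℂ) ≠ 0 := by exact_mod_cast NeZero.ne n
  have h' : (α : ℂ) * m + β * n = 1 := by exact_mod_cast h
  simp only [ZMod.stdAddChar_coe]
  rw [← Complex.exp_add]
  congr 1
  push_cast
  field_simp
  linear_combination (-(x : ℂ)) * h'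

theorem quadricSum_mul_modulus [DecidableEq ι] {m n : ℕ} [NeZero m] [NeZero n] [NeZero (m * n)]
    (hmn : m.Coprime n) {α β : ℤ} (h : α * m + β * n = 1) (k : ℤ) (u : ι → ℤ) :
    quadricSum ZMod.stdAddChar (k : ZMod (m * n)) (fun i => (u i : ZMod _)) =
      quadricSum ZMod.stdAddChar (k : ZMod m) (fun i => ((β * u i : ℤ) : ZMod _)) *
        quadricSum ZMod.stdAddChar (k : ZMod n) fun i => ((α * u i : ℤ) : ZMod _) := by
  set e := ZMod.chineseRemainder hmn
  rw [quadricSum, quadricSum, quadricSum, sum_mul_sum, ← sum_product']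
  refine sum_equiv ((Equiv.arrowCongr (Equiv.refl ι) e.toEquiv).trans
    (Equiv.arrowProdEquivProdArrow ι (fun _ => ZMod m) fun _ => ZMod n)) (fun x => ?_) fun x _ => ?_
  · rw [mem_product]
    simp only [mem_filter, mem_univ, true_and]
    rw [← map_eq_zero_iff e e.injective, Prod.ext_iff]
    simp [dotProduct, Prod.fst_sum, Prod.snd_sum]
  · obtain ⟨y, rfl⟩ := ZMod.intCast_surjective.comp_left x
    have hchar := stdAddChar_mul_modulus h (u ⬝ᵥ y)
    simp only [dotProduct, mul_sum, ← mul_assoc] at hchar ⊢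
    push_cast at hchar
    simpa using hchar

theorem IsResonant.of_mul_left {j g : ℕ} {c : ℤ} {u : ι → ℤ}
    (h : IsResonant j g fun i => c * u i) (hj : IsCoprime (j : ℤ) c) (hg : IsCoprime (g : ℤ) c) :
    IsResonant j g u := by
  refine ⟨fun i => hj.dvd_of_dvd_mul_left (h.1 i), ?_⟩
  have hsq : (fun i => c * u i) ⬝ᵥ (fun i => c * u i) = c ^ 2 * (u ⬝ᵥ u) := by
    simp only [dotProduct, mul_sum]
    exact sum_congr rfl fun i _ => by ring
  exact ((hj.pow (m := 2) (n := 2)).mul_left hg.pow_right).dvd_of_dvd_mul_left (hsq ▸ h.2)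

theorem IsResonant.mul {j g j' g' : ℕ} {u : ι → ℤ} (h : IsResonant j g u)
    (h' : IsResonant j' g' u) (hcop : IsCoprime ((j * g : ℕ) : ℤ) (j' * g' : ℕ)) :
    IsResonant (j * j') (g * g') u := by
  push_cast at hcop
  have hjj' := hcop.of_mul_left_left.of_mul_right_left
  have hjg' := hcop.of_mul_left_left.of_mul_right_right
  have hgj' := hcop.of_mul_left_right.of_mul_right_left
  have hgg' := hcop.of_mul_left_right.of_mul_right_right
  refine ⟨fun i => by exact_mod_cast hjj'.mul_dvd (h.1 i) (h'.1 i), ?_⟩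
  push_cast
  rw [mul_pow, mul_mul_mul_comm]
  exact (((hjj'.pow (m := 2) (n := 2)).mul_right hjg'.pow_left).mul_left
    (hgj'.pow_right.mul_right hgg')).mul_dvd h.2 h'.2

theorem QuadricSumBound.mul {m n : ℕ} [NeZero m] [NeZero n] [NeZero (m * n)] (hmn : m.Coprime n)
    {k : ℤ} {K L : ℝ} (hK : QuadricSumBound m k K) (hL : QuadricSumBound n k L) :
    QuadricSumBound (m * n) k (K * L) := by
  intro u
  have hmn' : IsCoprime (m : ℤ) n := Nat.isCoprime_iff_coprime.mpr hmn
  obtain ⟨α, β, h⟩ := id hmn'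
  have hβ : IsCoprime (m : ℤ) β := ⟨α, n, by linear_combination h⟩
  have hα : IsCoprime (n : ℤ) α := ⟨β, m, by linear_combination h⟩
  obtain ⟨j, g, hjg, hres, hle⟩ := hK fun i => β * u i
  obtain ⟨j', g', hjg', hres', hle'⟩ := hL fun i => α * u i
  have hjgm : ((j * g : ℕ) : ℤ) ∣ m := by exact_mod_cast hjg
  have hjgn : ((j' * g' : ℕ) : ℤ) ∣ n := by exact_mod_cast hjg'
  have cβ := hβ.of_isCoprime_of_dvd_left hjgm
  have cα := hα.of_isCoprime_of_dvd_left hjgn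
  push_cast at cβ cα
  refine ⟨j * j', g * g', ?_, ?_, ?_⟩
  · rw [mul_mul_mul_comm]
    exact mul_dvd_mul hjg hjg'
  · exact (hres.of_mul_left cβ.of_mul_left_left cβ.of_mul_left_right).mul
      (hres'.of_mul_left cα.of_mul_left_left cα.of_mul_left_right)
      ((hmn'.of_isCoprime_of_dvd_left hjgm).of_isCoprime_of_dvd_right hjgn)
  · rw [quadricSum_mul_modulus hmn h, norm_mul]
    calc _ ≤ (K * m * (j * √g)) * (L * n * (j' * √g')) :=
          mul_le_mul hle hle' (norm_nonneg _) ((norm_nonneg _).trans hle)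
      _ = _ := by
        push_cast
        rw [Real.sqrt_mul (Nat.cast_nonneg g)]
        ring

theorem quadricSumBound_squarefree_pow {r : ℕ} {k : ℤ} {A : ℝ}
    (h : ∀ p : ℕ, [Fact p.Prime] → QuadricSumBound (p ^ r) k A) (d : ℕ) :
    Squarefree d → ∀ [NeZero (d ^ r)], QuadricSumBound (d ^ r) k (A ^ #d.primeFactors) := by
  induction d using induction_on_primes with
  | zero => exact fun hd => absurd hd not_squarefree_zero
  | one => exact fun _ _ => (quadricSumBound_sq (1 ^ r) k).mono (by simp)
  | prime_mul p m hp ih =>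
    intro hd _
    have : Fact p.Prime := ⟨hp⟩
    obtain ⟨hcop, -, hm⟩ := Nat.squarefree_mul_iff.mp hd
    have : NeZero m := ⟨hm.ne_zero⟩
    have hcard : #(p * m).primeFactors = #m.primeFactors + 1 := by
      rw [hcop.primeFactors_mul, card_union_of_disjoint hcop.disjoint_primeFactors,
        hp.primeFactors, card_singleton, add_comm]
    have hmul := (h p).mul (hcop.pow r r) (ih hm)
    rw [← pow_succ', ← hcard] at hmul
    simpa only [mul_pow] using hmul

theorem exists_quadricSumBound (r : ℕ) (k : ℤ) :
    ∃ A : ℝ, 1 ≤ A ∧ ∀ d : ℕ, Squarefree d → ∀ [NeZero (d ^ r)],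
      QuadricSumBound (d ^ r) k (A ^ #d.primeFactors) := by
  refine ⟨max (4 * r + 1) (((2 * k.natAbs + 2 : ℝ) ^ r) ^ 2), le_max_of_le_left (by simp),
    fun d hd _ => quadricSumBound_squarefree_pow (fun p hp => ?_) d hd⟩
  by_cases hbad : p ≤ 2 * k.natAbs + 2
  · refine (quadricSumBound_sq (p ^ r) k).mono (le_max_of_le_right ?_)
    have hbad' : (p : ℝ) ≤ 2 * k.natAbs + 2 := by exact_mod_cast hbad
    rw [Nat.cast_pow]
    gcongr
  obtain ⟨ν, e, hν, rfl⟩ : ∃ ν e : ℤ, ¬ (p : ℤ) ∣ ν ∧ k = ν * e ^ 2 := by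
    rcases eq_or_ne k 0 with rfl | hk
    · exact ⟨1, 0, Int.ofNat_dvd.not.mpr hp.out.not_dvd_one, by norm_num⟩
    · refine ⟨k, 1, fun hpk => hbad ?_, by ring⟩
      have := Nat.le_of_dvd (Int.natAbs_pos.mpr hk) (Int.natCast_dvd.mp hpk)
      omega
  exact (quadricSumBound_prime_pow (by omega) hν e r).mono (le_max_left _ _)

end CoprimeModuli

section SolutionCounts

theorem card_filter_product_eq_piFinset {α : Type*} (s : Finset α) (P : (Fin 3 → α) → Prop)
    [DecidablePred P] [DecidablePred fun t : α × α × α => P ![t.1, t.2.1, t.2.2]] :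
    #{t ∈ s ×ˢ s ×ˢ s | P ![t.1, t.2.1, t.2.2]} = #{x ∈ Fintype.piFinset fun _ => s | P x} := by
  have eta (x : Fin 3 → α) : ![x 0, x 1, x 2] = x := by
    ext i
    fin_cases i <;> rfl
  refine card_nbij' (fun t => ![t.1, t.2.1, t.2.2]) (fun x => (x 0, x 1, x 2)) (fun t ht => ?_)
    (fun x hx => ?_) (fun _ _ => rfl) fun x _ => eta x
  · simpa [Fin.forall_fin_succ] using ht
  · simpa [Fin.forall_fin_succ, eta] using hx

theorem bijOn_natCast_Icc (q : ℕ) [NeZero q] :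
    Set.BijOn (Nat.cast : ℕ → ZMod q) (Set.Icc 1 q) Set.univ := by
  refine ⟨Set.mapsTo_univ _ _, fun a ha b hb hab => ?_, fun x _ => ?_⟩
  · have hdvd := Nat.modEq_iff_dvd.mp ((ZMod.natCast_eq_natCast_iff a b q).mp hab)
    have := Int.eq_zero_of_abs_lt_dvd hdvd (abs_lt.mpr (by grind))
    omega
  · rcases eq_or_ne x 0 with rfl | hx
    · exact ⟨q, ⟨NeZero.one_le, le_rfl⟩, ZMod.natCast_self q⟩
    · exact ⟨x.val, ⟨Nat.one_le_iff_ne_zero.mpr ((ZMod.val_ne_zero x).mpr hx), (ZMod.val_lt x).le⟩,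
        ZMod.natCast_zmod_val x⟩

theorem lam_eq_card (q : ℕ) [NeZero q] (k : ℤ) :
    lam q k = #{x : Fin 3 → ZMod q | x ⬝ᵥ x + k = 0} := by
  have hlam : lam q k = #{x ∈ Fintype.piFinset fun _ : Fin 3 => Icc 1 q |
      (fun i => (x i : ZMod q)) ⬝ᵥ (fun i => (x i : ZMod q)) + k = 0} := by
    rw [lam, ← card_filter_product_eq_piFinset]
    congr 1
    refine filter_congr fun t _ => ?_
    rw [← ZMod.intCast_eq_intCast_iff]
    simp [dotProduct, Fin.sum_univ_succ, sq, add_assoc]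
  rw [hlam]
  refine card_nbij (fun x i => (x i : ZMod q)) (fun x hx => by simpa using (mem_filter.mp hx).2)
    (fun x hx y hy hxy => funext fun i => ?_) fun y hy => ?_
  · simp only [coe_filter, Fintype.mem_piFinset, mem_Icc, Set.mem_ofPred_eq] at hx hy
    exact (bijOn_natCast_Icc q).injOn (hx.1 i) (hy.1 i) (congrFun hxy i)
  · choose x hx hxy using fun i => (bijOn_natCast_Icc q).surjOn (Set.mem_univ (y i))
    obtain rfl : (fun i => (x i : ZMod q)) = y := funext hxy
    refine ⟨x, ?_, rfl⟩
    simp only [coe_filter, mem_univ, true_and, Set.mem_ofPred_eq] at hy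
    simpa [Fintype.mem_piFinset] using ⟨hx, hy⟩

theorem lam_eq_quadricSum (q : ℕ) [NeZero q] (k : ℤ) :
    (lam q k : ℂ) =
      quadricSum ZMod.stdAddChar (k : ZMod q) fun _ : Fin 3 => ((0 : ℤ) : ZMod q) := by
  simp [lam_eq_card, quadricSum, dotProduct]

theorem lam_one (k : ℤ) : lam 1 k = 1 := by
  simp [lam, Int.modEq_one]

theorem lam_mul {m n : ℕ} (hm : m ≠ 0) (hn : n ≠ 0) (hmn : m.Coprime n) (k : ℤ) :
    lam (m * n) k = lam m k * lam n k := by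
  have : NeZero m := ⟨hm⟩
  have : NeZero n := ⟨hn⟩
  obtain ⟨α, β, h⟩ := Nat.isCoprime_iff_coprime.mpr hmn
  have hmul := quadricSum_mul_modulus hmn h k fun _ : Fin 3 => 0
  simp only [mul_zero, ← lam_eq_quadricSum] at hmul
  exact_mod_cast hmul

theorem QuadricSumBound.lam_le {q : ℕ} [NeZero q] {k : ℤ} {K : ℝ} (hK : 0 ≤ K)
    (h : QuadricSumBound q k K) : (lam q k : ℝ) ≤ K * q ^ 2 := by
  obtain ⟨j, g, hjg, -, hle⟩ := h 0
  have hsqrt : √(g : ℝ) ≤ g := by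
    rw [Real.sqrt_le_left (by positivity)]
    exact_mod_cast Nat.le_self_pow two_ne_zero g
  have hjg' : (j : ℝ) * g ≤ q := by exact_mod_cast Nat.le_of_dvd (NeZero.pos q) hjg
  simp only [Pi.zero_apply, ← lam_eq_quadricSum, Complex.norm_natCast] at hle
  calc (lam q k : ℝ) ≤ K * q * (j * √g) := hle
    _ ≤ K * q * (j * g) := by gcongr
    _ ≤ K * q * q := by gcongr
    _ = K * q ^ 2 := by ring

end SolutionCounts

section DivisorBound

theorem prod_primeFactors_le {f : ℕ → ℕ → ℝ} {ε c : ℝ} {P : ℕ} (hc : 1 ≤ c)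
    (hf : ∀ p e, 0 ≤ f p e)
    (hlarge : ∀ p e, p.Prime → P ≤ p → e ≠ 0 → f p e ≤ ((p ^ e : ℕ) : ℝ) ^ ε)
    (hall : ∀ p e, p.Prime → e ≠ 0 → f p e ≤ c * ((p ^ e : ℕ) : ℝ) ^ ε) {n : ℕ} (hn : n ≠ 0) :
    ∏ p ∈ n.primeFactors, f p (n.factorization p) ≤ c ^ P * (n : ℝ) ^ ε := by
  have hlocal : ∀ p ∈ n.primeFactors, f p (n.factorization p) ≤
      (if p < P then c else 1) * ((p ^ n.factorization p : ℕ) : ℝ) ^ ε := fun p hp => by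
    have hpp := Nat.prime_of_mem_primeFactors hp
    have he := (hpp.factorization_pos_of_dvd hn (Nat.dvd_of_mem_primeFactors hp)).ne'
    split_ifs with h
    · exact hall p _ hpp he
    · rw [one_mul]
      exact hlarge p _ hpp (not_lt.mp h) he
  have hcard : #{p ∈ n.primeFactors | p < P} ≤ P :=
    (card_le_card fun p hp => mem_range.mpr (mem_filter.mp hp).2).trans_eq (card_range P)
  calc _ ≤ ∏ p ∈ n.primeFactors,
        ((if p < P then c else 1) * ((p ^ n.factorization p : ℕ) : ℝ) ^ ε) :=
        prod_le_prod (fun p _ => hf _ _) hlocal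
    _ = c ^ #{p ∈ n.primeFactors | p < P} * (n : ℝ) ^ ε := by
        rw [prod_mul_distrib, prod_ite, prod_const, prod_const_one, mul_one,
          Real.finsetProd_rpow _ _ fun p _ => Nat.cast_nonneg _, ← Nat.cast_prod]
        congr 3
        exact Nat.prod_factorization_pow_eq_self hn
    _ ≤ c ^ P * (n : ℝ) ^ ε := by gcongr

theorem exists_pow_card_primeFactors_le {A ε : ℝ} (hA : 1 ≤ A) (hε : 0 < ε) :
    ∃ C : ℝ, 0 < C ∧ ∀ n : ℕ, n ≠ 0 → A ^ #n.primeFactors ≤ C * (n : ℝ) ^ ε := by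
  obtain ⟨P, hP⟩ := exists_nat_ge (A ^ ε⁻¹)
  refine ⟨A ^ P, by positivity, fun n hn => ?_⟩
  rw [← prod_const]
  refine prod_primeFactors_le (f := fun _ _ => A) hA (fun _ _ => by positivity)
    (fun p e _ hPp he => ?_) (fun p e hp _ => ?_) hn
  · rw [← Real.rpow_inv_le_iff_of_pos (by positivity) (by positivity) hε]
    exact hP.trans (by exact_mod_cast hPp.trans (Nat.le_self_pow he p))
  · have hpe : (1 : ℝ) ≤ (p ^ e : ℕ) := by exact_mod_cast Nat.one_le_pow _ _ hp.pos
    exact le_mul_of_one_le_right (by positivity) (Real.one_le_rpow hpe hε.le)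

theorem add_one_le_mul_rpow {ε : ℝ} (hε : 0 < ε) {p : ℕ} (hp : 2 ≤ p) (e : ℕ) :
    (e : ℝ) + 1 ≤ ((ε * Real.log 2)⁻¹ + 1) * ((p ^ e : ℕ) : ℝ) ^ ε := by
  have hlog : 0 < ε * Real.log 2 := mul_pos hε (Real.log_pos one_lt_two)
  have hpe : (2 : ℝ) ^ e ≤ (p ^ e : ℕ) := by exact_mod_cast Nat.pow_le_pow_left hp e
  have hone : 1 ≤ ((p ^ e : ℕ) : ℝ) ^ ε :=
    Real.one_le_rpow ((one_le_pow₀ one_le_two).trans hpe) hε.le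
  have hexp : (ε * Real.log 2) * e ≤ ((p ^ e : ℕ) : ℝ) ^ ε :=
    calc (ε * Real.log 2) * e ≤ Real.exp ((ε * Real.log 2) * e) :=
          (le_add_of_nonneg_right zero_le_one).trans (Real.add_one_le_exp _)
      _ = ((2 : ℝ) ^ e) ^ ε := by
          rw [Real.rpow_def_of_pos (by positivity), Real.log_pow]
          ring_nf
      _ ≤ _ := by gcongr
  rw [add_mul, one_mul]
  exact add_le_add ((le_inv_mul_iff₀ hlog).mpr hexp) hone

theorem exists_card_divisors_le {ε : ℝ} (hε : 0 < ε) :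
    ∃ C : ℝ, 0 < C ∧ ∀ n : ℕ, n ≠ 0 → (#n.divisors : ℝ) ≤ C * (n : ℝ) ^ ε := by
  obtain ⟨P, hP⟩ := exists_nat_ge ((2 : ℝ) ^ ε⁻¹)
  have hc : 0 ≤ (ε * Real.log 2)⁻¹ := by positivity
  refine ⟨((ε * Real.log 2)⁻¹ + 1) ^ P, by positivity, fun n hn => ?_⟩
  rw [Nat.card_divisors hn]
  push_cast
  refine prod_primeFactors_le (f := fun _ e => (e : ℝ) + 1) (le_add_of_nonneg_left hc)
    (fun _ _ => by positivity) (fun p e _ hPp _ => ?_)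
    (fun p e hp _ => add_one_le_mul_rpow hε hp.two_le e) hn
  have hpε : (2 : ℝ) ≤ (p : ℝ) ^ ε := by
    rw [← Real.rpow_inv_le_iff_of_pos zero_le_two (Nat.cast_nonneg p) hε]
    exact hP.trans (by exact_mod_cast hPp)
  calc (e : ℝ) + 1 ≤ 2 ^ e := by exact_mod_cast Nat.lt_two_pow_self
    _ ≤ ((p : ℝ) ^ ε) ^ e := by gcongr
    _ = ((p ^ e : ℕ) : ℝ) ^ ε := by
      rw [Nat.cast_pow, Real.rpow_pow_comm (Nat.cast_nonneg p)]

theorem exists_dvd_and_dvd_of_dvd_mul_int {n : ℕ} (hn : n ≠ 0) {a b : ℤ} (h : (n : ℤ) ∣ a * b) :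
    ∃ t ∈ n.divisorsAntidiagonal, (t.1 : ℤ) ∣ a ∧ (t.2 : ℤ) ∣ b := by
  rw [Int.natCast_dvd, Int.natAbs_mul] at h
  obtain ⟨c, d, hc, hd, rfl⟩ := exists_dvd_and_dvd_of_dvd_mul h
  exact ⟨(c, d), Nat.mem_divisorsAntidiagonal.mpr ⟨rfl, hn⟩, Int.natCast_dvd.mpr hc,
    Int.natCast_dvd.mpr hd⟩

theorem card_divisorsAntidiagonal (n : ℕ) : #n.divisorsAntidiagonal = #n.divisors := by
  rw [← Nat.map_div_right_divisors, card_map]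

end DivisorBound

section RootSums

theorem sum_inv_residue_class_le {g M : ℕ} (hg : 0 < g) (hgM : g ≤ M * M) (X : ℕ) (ρ : ℤ) :
    ∑ w ∈ (Icc 1 X).filter fun w : ℕ => (M : ℤ) ∣ (w : ℤ) - ρ ∧ g ≤ 3 * w ^ 2, (1 : ℝ) / w ≤
      (3 + Real.log X) / √g := by
  set T := (Icc 1 X).filter fun w : ℕ => (M : ℤ) ∣ (w : ℤ) - ρ ∧ g ≤ 3 * w ^ 2
  have mem_T {w : ℕ} : w ∈ T ↔ (1 ≤ w ∧ w ≤ X) ∧ (M : ℤ) ∣ (w : ℤ) - ρ ∧ g ≤ 3 * w ^ 2 := by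
    rw [mem_filter, mem_Icc]
  have hg' : 0 < √(g : ℝ) := Real.sqrt_pos.mpr (by exact_mod_cast hg)
  have hMg : √(g : ℝ) ≤ M := Real.sqrt_le_iff.mpr ⟨by positivity, by rw [sq]; exact_mod_cast hgM⟩
  have hinj : Set.InjOn (· / M) (T : Set ℕ) := by
    intro w hw w' hw' heq
    have hmod : w ≡ w' [MOD M] :=
      Nat.modEq_iff_dvd.mpr (by simpa using dvd_sub (mem_T.mp hw').2.1 (mem_T.mp hw).2.1)
    exact Nat.ext_div_mod heq hmod
  set f : ℕ → ℝ := fun i => if i = 0 then 2 / √g else (1 / √g) * (i : ℝ)⁻¹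
  have hf (i : ℕ) : 0 ≤ f i := by positivity
  have hle : ∀ w ∈ T, (1 : ℝ) / w ≤ f (w / M) := by
    intro w hw
    obtain ⟨⟨hw1, -⟩, -, hgw⟩ := mem_T.mp hw
    have hw0 : (0 : ℝ) < w := by exact_mod_cast hw1
    simp only [f]
    split_ifs with hi
    · rw [div_le_div_iff₀ hw0 hg', one_mul, Real.sqrt_le_left (by positivity)]
      have : (g : ℝ) ≤ 3 * w ^ 2 := by exact_mod_cast hgw
      nlinarith
    · rw [one_div, one_div, ← mul_inv]
      have hi' : (0 : ℝ) < (w / M : ℕ) := by exact_mod_cast Nat.pos_of_ne_zero hi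
      gcongr
      exact (mul_le_mul_of_nonneg_right hMg hi'.le).trans (by exact_mod_cast Nat.mul_div_le w M)
  calc ∑ w ∈ T, (1 : ℝ) / w ≤ ∑ w ∈ T, f (w / M) := sum_le_sum hle
    _ = ∑ i ∈ T.image (· / M), f i := (sum_image hinj).symm
    _ ≤ ∑ i ∈ range (X + 1), f i := by
        refine sum_le_sum_of_subset_of_nonneg (fun i hi => ?_) fun i _ _ => hf i
        obtain ⟨w, hw, rfl⟩ := mem_image.mp hi
        exact mem_range_succ_iff.mpr ((Nat.div_le_self _ _).trans (mem_T.mp hw).1.2)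
    _ = (1 / √g) * harmonic X + 2 / √g := by
        simp [sum_range_succ', f, harmonic, mul_sum]
    _ ≤ (1 / √g) * (1 + Real.log X) + 2 / √g := by
        gcongr
        exact harmonic_le_one_add_log X
    _ = (3 + Real.log X) / √g := by ring

/-- Grouping the roots by how `g` splits over `(w - w₀) (w + w₀)` for a fixed root `w₀`, each group
lies in a residue class modulo the larger part, which is at least `√g`. -/
theorem sum_inv_roots_le {g : ℕ} (hg : 0 < g) (X : ℕ) (c : ℤ) :
    ∑ w ∈ (Icc 1 X).filter fun w : ℕ => (g : ℤ) ∣ (w : ℤ) ^ 2 + c ∧ g ≤ 3 * w ^ 2, (1 : ℝ) / w ≤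
      #g.divisors * ((3 + Real.log X) / √g) := by
  have : 0 ≤ Real.log X := Real.log_natCast_nonneg X
  set T := (Icc 1 X).filter fun w : ℕ => (g : ℤ) ∣ (w : ℤ) ^ 2 + c ∧ g ≤ 3 * w ^ 2
  rcases T.eq_empty_or_nonempty with hempty | ⟨w₀, hw₀⟩
  · rw [hempty, sum_empty]
    positivity
  have hsplit : ∀ w ∈ T, ∃ t ∈ g.divisorsAntidiagonal,
      (t.1 : ℤ) ∣ (w : ℤ) - w₀ ∧ (t.2 : ℤ) ∣ (w : ℤ) - (-w₀) := fun w hw => by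
    refine exists_dvd_and_dvd_of_dvd_mul_int hg.ne' ?_
    rw [show ((w : ℤ) - w₀) * ((w : ℤ) - (-w₀)) = (w ^ 2 + c) - (w₀ ^ 2 + c) by ring]
    exact dvd_sub (mem_filter.mp hw).2.1 (mem_filter.mp hw₀).2.1
  choose! t ht hdvd using hsplit
  have hfiber : ∀ ab ∈ g.divisorsAntidiagonal,
      ∑ w ∈ T with t w = ab, (1 : ℝ) / w ≤ (3 + Real.log X) / √g := by
    rintro ⟨a, b⟩ hab
    obtain ⟨M, ρ, hgM, hM⟩ : ∃ (M : ℕ) (ρ : ℤ), g ≤ M * M ∧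
        ∀ w ∈ T, t w = (a, b) → (M : ℤ) ∣ (w : ℤ) - ρ := by
      rw [← (Nat.mem_divisorsAntidiagonal.mp hab).1]
      rcases le_total a b with h | h
      · exact ⟨b, -w₀, Nat.mul_le_mul_right b h, fun w hw hwt => by simpa [hwt] using (hdvd w hw).2⟩
      · exact ⟨a, w₀, Nat.mul_le_mul_left a h, fun w hw hwt => by simpa [hwt] using (hdvd w hw).1⟩
    refine le_trans (sum_le_sum_of_subset_of_nonneg (fun w hw => ?_)
      fun w _ _ => one_div_nonneg.mpr (Nat.cast_nonneg w)) (sum_inv_residue_class_le hg hgM X ρ)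
    obtain ⟨hwT, hwt⟩ := mem_filter.mp hw
    exact mem_filter.mpr ⟨(mem_filter.mp hwT).1, hM w hwT hwt, (mem_filter.mp hwT).2.2⟩
  rw [← sum_fiberwise_of_maps_to ht, ← card_divisorsAntidiagonal, ← nsmul_eq_mul]
  exact sum_le_card_nsmul _ _ _ hfiber

end RootSums

section SumsOfTwoSquares

theorem coprime_sq_add_sq {y z : ℕ} (h : y.Coprime z) :
    (y ^ 2 + z ^ 2).Coprime y ∧ (y ^ 2 + z ^ 2).Coprime z := by
  rw [sq, sq, Nat.coprime_mul_right_add_left, Nat.coprime_add_mul_right_left]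
  exact ⟨(h.mul_right h).symm, h.mul_left h⟩

theorem not_four_dvd_sq_add_sq {y z : ℕ} (h : y.Coprime z) : ¬ 4 ∣ y ^ 2 + z ^ 2 := fun h4 =>
  absurd (ZMod.isSquare_neg_one_of_dvd h4
    (ZMod.isSquare_neg_one_of_eq_sq_add_sq_of_coprime rfl h)) (by decide)

theorem coprime_of_dvd_cross {y z y₀ z₀ b b' : ℕ} (hyz : y.Coprime z) (hyz₀ : y₀.Coprime z₀)
    (h : y ^ 2 + z ^ 2 = b * b') (h₀ : y₀ ^ 2 + z₀ ^ 2 = b * b')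
    (hb : (b : ℤ) ∣ y * z₀ - z * y₀) (hb' : (b' : ℤ) ∣ y * z₀ + z * y₀) : b.Coprime b' := by
  refine Nat.Coprime.symm (Nat.coprime_of_dvd fun p hp hpb' hpb => ?_)
  have hpn : p ∣ b * b' := hpb.mul_right b'
  have hpy : ¬ p ∣ y := fun hpy =>
    Nat.not_coprime_of_dvd_of_dvd hp.one_lt hpn hpy (h ▸ (coprime_sq_add_sq hyz).1)
  have hpz : ¬ p ∣ z₀ := fun hpz =>
    Nat.not_coprime_of_dvd_of_dvd hp.one_lt hpn hpz (h₀ ▸ (coprime_sq_add_sq hyz₀).2)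
  have hp2 : p ∣ 2 * (y * z₀) := by
    have hsum := dvd_add ((Int.natCast_dvd_natCast.mpr hpb).trans hb)
      ((Int.natCast_dvd_natCast.mpr hpb').trans hb')
    rw [sub_add_add_cancel, ← two_mul] at hsum
    exact_mod_cast hsum
  rcases hp.dvd_mul.mp hp2 with h2 | hpyz
  · obtain rfl := (Nat.prime_dvd_prime_iff_eq hp Nat.prime_two).mp h2
    exact not_four_dvd_sq_add_sq hyz (h ▸ mul_dvd_mul hpb hpb')
  · exact (hp.dvd_mul.mp hpyz).elim hpy hpz

theorem eq_of_sq_add_sq_of_dvd_cross {n y z y' z' : ℕ} (hy : 0 < y) (hz : 0 < z) (hy' : 0 < y')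
    (hz' : 0 < z') (h : y ^ 2 + z ^ 2 = n) (h' : y' ^ 2 + z' ^ 2 = n) (hc : y.Coprime z)
    (hc' : y'.Coprime z') (hd : (n : ℤ) ∣ y * z' - z * y') : y = y' ∧ z = z' := by
  zify at h h'
  have hlagrange : (y * z' - z * y' : ℤ) ^ 2 + (y * y' + z * z') ^ 2 = n ^ 2 := by
    rw [sq (n : ℤ)]
    nth_rw 1 [← h]
    rw [← h']
    ring
  have hlt : |(y * z' - z * y' : ℤ)| < n := by
    have : (0 : ℤ) < y * y' + z * z' := by positivity
    rw [← sq_lt_sq₀ (abs_nonneg _) (by positivity), sq_abs]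
    nlinarith
  have hcross : y * z' = z * y' := by
    exact_mod_cast sub_eq_zero.mp (Int.eq_zero_of_abs_lt_dvd hd hlt)
  obtain rfl : y = y' := Nat.dvd_antisymm (hc.dvd_of_dvd_mul_left (Dvd.intro _ hcross))
    (hc'.dvd_of_dvd_mul_right (Dvd.intro_left _ hcross.symm))
  rw [mul_comm] at hcross
  exact ⟨rfl, (Nat.eq_of_mul_eq_mul_right hy hcross).symm⟩

/-- Comparing `t` with a fixed solution `(y₀, z₀)` splits `n` over the two factors of
`t.1² z₀² - t.2² y₀²`, and the splitting determines `t`. -/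
theorem card_primitive_sq_add_sq_le {n : ℕ} {s : Finset (ℕ × ℕ)}
    (hs : ∀ t ∈ s, (0 < t.1 ∧ 0 < t.2) ∧ t.1.Coprime t.2 ∧ t.1 ^ 2 + t.2 ^ 2 = n) :
    #s ≤ #n.divisors := by
  rcases s.eq_empty_or_nonempty with rfl | ⟨⟨y₀, z₀⟩, h₀⟩
  · simp
  obtain ⟨⟨hy₀, -⟩, hc₀, rfl⟩ := hs _ h₀
  set n := y₀ ^ 2 + z₀ ^ 2
  have hn : n ≠ 0 := (Nat.add_pos_left (by positivity) _).ne'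
  have hsplit : ∀ t ∈ s, ∃ d ∈ n.divisorsAntidiagonal,
      (d.1 : ℤ) ∣ t.1 * z₀ - t.2 * y₀ ∧ (d.2 : ℤ) ∣ t.1 * z₀ + t.2 * y₀ := by
    intro t ht
    refine exists_dvd_and_dvd_of_dvd_mul_int hn ⟨(t.1 : ℤ) ^ 2 - y₀ ^ 2, ?_⟩
    have heq : (t.1 : ℤ) ^ 2 + t.2 ^ 2 = n := by exact_mod_cast (hs t ht).2.2
    have hn_cast : (n : ℤ) = y₀ ^ 2 + z₀ ^ 2 := by simp [n]
    linear_combination (-(y₀ : ℤ) ^ 2) * heq - (t.1 : ℤ) ^ 2 * hn_cast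
  choose! d hd hdvd using hsplit
  rw [← card_divisorsAntidiagonal]
  refine card_le_card_of_injOn d hd fun t ht t' ht' heq => ?_
  obtain ⟨⟨hy, hz⟩, hc, hyz⟩ := hs t ht
  obtain ⟨⟨hy', hz'⟩, hc', hyz'⟩ := hs t' ht'
  have hprod : (d t).1 * (d t).2 = n := (Nat.mem_divisorsAntidiagonal.mp (hd t ht)).1
  obtain ⟨h₁, h₂⟩ := hdvd t ht
  obtain ⟨h₁', h₂'⟩ := heq ▸ hdvd t' ht'
  have hz₀ {a : ℕ} (ha : a ∣ n) : IsCoprime (a : ℤ) z₀ :=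
    Nat.isCoprime_iff_coprime.mpr ((coprime_sq_add_sq hc₀).2.coprime_dvd_left ha)
  have hcop : IsCoprime ((d t).1 : ℤ) (d t).2 := Nat.isCoprime_iff_coprime.mpr
    (coprime_of_dvd_cross hc hc₀ (hyz.trans hprod.symm) hprod.symm h₁ h₂)
  have hdvd₁ : ((d t).1 : ℤ) ∣ t.1 * t'.2 - t.2 * t'.1 := by
    refine (hz₀ (Dvd.intro _ hprod)).dvd_of_dvd_mul_left ?_
    convert dvd_sub (h₁.mul_left t'.2) (h₁'.mul_left t.2) using 1
    ring
  have hdvd₂ : ((d t).2 : ℤ) ∣ t.1 * t'.2 - t.2 * t'.1 := by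
    refine (hz₀ (Dvd.intro_left _ hprod)).dvd_of_dvd_mul_left ?_
    convert dvd_sub (h₂.mul_left t'.2) (h₂'.mul_left t.2) using 1
    ring
  have hcross : (n : ℤ) ∣ t.1 * t'.2 - t.2 * t'.1 := by
    rw [← hprod]
    exact_mod_cast hcop.mul_dvd hdvd₁ hdvd₂
  exact Prod.ext_iff.mpr (eq_of_sq_add_sq_of_dvd_cross hy hz hy' hz' hyz hyz' hc hc' hcross)

theorem card_sq_add_sq_le {n : ℕ} (hn : n ≠ 0) {s : Finset (ℕ × ℕ)}
    (hs : ∀ t ∈ s, (0 < t.1 ∧ 0 < t.2) ∧ t.1 ^ 2 + t.2 ^ 2 = n) : #s ≤ #n.divisors ^ 2 := by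
  have hgcd : ∀ t ∈ s, t.1.gcd t.2 ^ 2 ∣ n := fun t ht => (hs t ht).2 ▸
    dvd_add (pow_dvd_pow_of_dvd (Nat.gcd_dvd_left _ _) 2)
      (pow_dvd_pow_of_dvd (Nat.gcd_dvd_right _ _) 2)
  have hmaps : ∀ t ∈ s, t.1.gcd t.2 ∈ n.divisors := fun t ht =>
    Nat.mem_divisors.mpr ⟨(dvd_pow_self _ two_ne_zero).trans (hgcd t ht), hn⟩
  rw [card_eq_sum_card_fiberwise hmaps, sq, ← smul_eq_mul]
  refine sum_le_card_nsmul _ _ _ fun e he => ?_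
  have he0 : 0 < e := Nat.pos_of_mem_divisors he
  have hscale : ∀ t ∈ s, t.1.gcd t.2 = e → ∃ t' : ℕ × ℕ, t = (e * t'.1, e * t'.2) ∧
      t'.1.Coprime t'.2 := by
    rintro ⟨y, z⟩ - rfl
    obtain ⟨y', z', hc, hy, hz⟩ := Nat.exists_coprime y z
    exact ⟨(y', z'), by rw [mul_comm _ y', mul_comm _ z', ← hy, ← hz], hc⟩
  choose! f hf hfc using hscale
  have hinj : Set.InjOn f ({t ∈ s | t.1.gcd t.2 = e} : Finset (ℕ × ℕ)) := by
    intro t ht t' ht' heq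
    obtain ⟨hts, hte⟩ := mem_filter.mp ht
    obtain ⟨hts', hte'⟩ := mem_filter.mp ht'
    exact (hf t hts hte).trans (heq ▸ (hf t' hts' hte').symm)
  rw [← card_image_of_injOn hinj]
  rcases ({t ∈ s | t.1.gcd t.2 = e}).eq_empty_or_nonempty with hempty | ⟨t₀, ht₀⟩
  · simp [hempty]
  obtain ⟨m, rfl⟩ : e ^ 2 ∣ n := (mem_filter.mp ht₀).2 ▸ hgcd t₀ (mem_filter.mp ht₀).1
  refine (card_primitive_sq_add_sq_le (n := m) ?_).trans
    (card_le_card (Nat.divisors_subset_of_dvd hn (dvd_mul_left m _)))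
  rintro _ ht'
  obtain ⟨t, ht, rfl⟩ := mem_image.mp ht'
  obtain ⟨hts, hte⟩ := mem_filter.mp ht
  obtain ⟨⟨hpos₁, hpos₂⟩, heq⟩ := hs t hts
  rw [hf t hts hte] at hpos₁ hpos₂ heq
  refine ⟨⟨Nat.pos_of_mul_pos_left hpos₁, Nat.pos_of_mul_pos_left hpos₂⟩, hfc t hts hte,
    Nat.eq_of_mul_eq_mul_left (pow_pos he0 2) ?_⟩
  rw [← heq, mul_pow, mul_pow, mul_add]

end SumsOfTwoSquares

/-- The number of vectors `x ∈ [1, N] ^ 3` with `q ∣ x₀ ^ 2 + x₁ ^ 2 + x₂ ^ 2 + k`. -/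
def divCount (N q : ℕ) (k : ℤ) : ℕ :=
  #{x ∈ Fintype.piFinset fun _ : Fin 3 => Icc 1 N | (q : ℤ) ∣ ∑ i, (x i : ℤ) ^ 2 + k}

section Fourier

variable {q : ℕ} [NeZero q]

/-- The Fourier coefficient at the frequency `u` of the interval `[1, N]`, viewed modulo `q`. -/
noncomputable def intervalSum (N : ℕ) (u : ZMod q) : ℂ :=
  ∑ n ∈ Icc 1 N, ZMod.stdAddChar (-(u * (n : ZMod q)))

theorem prod_intervalSum {ι : Type*} [Fintype ι] [DecidableEq ι] (N : ℕ) (u : ι → ZMod q) :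
    ∏ i, intervalSum N (u i) =
      ∑ n ∈ Fintype.piFinset fun _ : ι => Icc 1 N,
        ZMod.stdAddChar (-(u ⬝ᵥ fun i => (n i : ZMod q))) := by
  simp only [intervalSum, prod_univ_sum, dotProduct, ← sum_neg_distrib, addChar_sum_eq_prod]

theorem divCount_eq_sum (N : ℕ) (k : ℤ) :
    (q : ℂ) ^ 3 * divCount N q k = ∑ u : Fin 3 → ZMod q,
      quadricSum ZMod.stdAddChar (k : ZMod q) u * ∏ i, intervalSum N (u i) := by
  have sum_frequencies (x : Fin 3 → ZMod q) (n : Fin 3 → ℕ) :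
      ∑ u : Fin 3 → ZMod q,
        ZMod.stdAddChar (u ⬝ᵥ x) * ZMod.stdAddChar (-(u ⬝ᵥ fun i => (n i : ZMod q))) =
      if x = (fun i => (n i : ZMod q)) then (q : ℂ) ^ 3 else 0 := by
    simp only [← AddChar.map_add_eq_mul, ← sub_eq_add_neg, ← dotProduct_sub]
    rw [sum_addChar_dotProduct (ZMod.isPrimitive_stdAddChar q)]
    simp only [sub_eq_zero, ZMod.card, Fintype.card_fin]
  have mem_quadric (n : Fin 3 → ℕ) : (q : ℤ) ∣ ∑ i, (n i : ℤ) ^ 2 + k ↔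
      (fun i => (n i : ZMod q)) ⬝ᵥ (fun i => (n i : ZMod q)) + (k : ZMod q) = 0 := by
    rw [← ZMod.intCast_zmod_eq_zero_iff_dvd]
    simp only [dotProduct, sq, Int.cast_add, Int.cast_sum, Int.cast_mul, Int.cast_natCast]
  calc (q : ℂ) ^ 3 * divCount N q k
      = ∑ n ∈ Fintype.piFinset fun _ : Fin 3 => Icc 1 N,
          ∑ x : Fin 3 → ZMod q with x ⬝ᵥ x + (k : ZMod q) = 0,
            if x = (fun i => (n i : ZMod q)) then (q : ℂ) ^ 3 else 0 := by
        simp only [divCount, card_filter, mem_quadric, Nat.cast_sum, mul_sum, sum_ite_eq',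
          mem_filter, mem_univ, true_and, Nat.cast_ite, Nat.cast_one, Nat.cast_zero, mul_ite,
          mul_one, mul_zero]
    _ = ∑ u : Fin 3 → ZMod q,
          quadricSum ZMod.stdAddChar (k : ZMod q) u * ∏ i, intervalSum N (u i) := by
        simp only [← sum_frequencies, prod_intervalSum, quadricSum, sum_mul_sum]
        rw [sum_comm, sum_comm (s := univ)]
        exact sum_congr rfl fun x _ => sum_comm

theorem norm_intervalSum_le (N : ℕ) (u : ZMod q) : ‖intervalSum N u‖ ≤ N := by
  simpa only [intervalSum, Nat.card_Icc, Nat.add_sub_cancel] using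
    norm_sum_addChar_le (ψ := ZMod.stdAddChar) (Icc 1 N) fun n => -(u * (n : ZMod q))

theorem abs_valMinAbs_div_le_norm_stdAddChar_sub_one (u : ZMod q) :
    4 * |(u.valMinAbs : ℝ)| / q ≤ ‖(ZMod.stdAddChar u : ℂ) - 1‖ := by
  have hq : (0 : ℝ) < q := by exact_mod_cast NeZero.pos q
  set θ : ℝ := 2 * Real.pi * u.valMinAbs / q with hθ
  have exp_eq : (ZMod.stdAddChar u : ℂ) = Complex.exp (Complex.I * (θ : ℂ)) := by
    conv_lhs => rw [← ZMod.coe_valMinAbs u, ZMod.stdAddChar_coe]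
    rw [hθ]
    push_cast
    ring_nf
  have abs_half : |θ / 2| = Real.pi * |(u.valMinAbs : ℝ)| / q := by
    rw [hθ, abs_div, abs_div, abs_mul, abs_mul, abs_of_pos Real.pi_pos, abs_of_pos hq, abs_two]
    ring
  have valMinAbs_le : |(u.valMinAbs : ℝ)| * 2 ≤ q := by
    have h := ZMod.valMinAbs_mem_Ioc u
    have : |u.valMinAbs * 2| ≤ q := abs_le.mpr ⟨h.1.le, h.2⟩
    rw [abs_mul, abs_two] at this
    exact_mod_cast this
  have sin_bound := Real.mul_abs_le_abs_sin (x := θ / 2) (by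
    rw [abs_half, mul_div_assoc]
    refine mul_le_mul_of_nonneg_left ?_ Real.pi_pos.le |>.trans_eq (mul_one_div _ _)
    rw [div_le_div_iff₀ hq two_pos, one_mul]
    exact valMinAbs_le)
  calc 4 * |(u.valMinAbs : ℝ)| / q = 2 * (2 / Real.pi * |θ / 2|) := by
        rw [abs_half]
        field_simp
        ring
    _ ≤ 2 * |Real.sin (θ / 2)| := by gcongr
    _ = ‖(ZMod.stdAddChar u : ℂ) - 1‖ := by
        rw [exp_eq, Complex.norm_exp_I_mul_ofReal_sub_one, Real.norm_eq_abs, abs_mul, abs_two]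

theorem norm_intervalSum_le_div (N : ℕ) {u : ZMod q} (hu : u ≠ 0) :
    ‖intervalSum N u‖ ≤ q / |(u.valMinAbs : ℝ)| := by
  have hq : (0 : ℝ) < q := by exact_mod_cast NeZero.pos q
  have hu' : 0 < |((-u).valMinAbs : ℝ)| := by
    rw [abs_pos, Int.cast_ne_zero, Ne, ZMod.valMinAbs_eq_zero, neg_eq_zero]
    exact hu
  set z : ℂ := ZMod.stdAddChar (-u) with hz
  have dist_one : 4 * |((-u).valMinAbs : ℝ)| / q ≤ ‖z - 1‖ :=
    abs_valMinAbs_div_le_norm_stdAddChar_sub_one (-u)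
  have ne_one : z ≠ 1 := sub_ne_zero.mp (norm_pos_iff.mp (lt_of_lt_of_le (by positivity) dist_one))
  have geometric : intervalSum N u = (z ^ (N + 1) - z ^ 1) / (z - 1) := by
    rw [← geom_sum_Ico ne_one (by omega), intervalSum]
    refine sum_congr rfl fun n _ => ?_
    rw [hz, ← AddChar.map_nsmul_eq_pow, nsmul_eq_mul, mul_neg, mul_comm]
  have numerator : ‖z ^ (N + 1) - z ^ 1‖ ≤ 2 := by
    refine (norm_sub_le _ _).trans (le_of_eq ?_)
    rw [norm_pow, norm_pow, hz, AddChar.norm_apply]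
    norm_num
  have abs_neg_eq : |((-u).valMinAbs : ℝ)| = |(u.valMinAbs : ℝ)| := by
    rw [← Int.cast_abs, ← Int.cast_abs, Int.abs_eq_natAbs, Int.abs_eq_natAbs,
      ZMod.natAbs_valMinAbs_neg]
  rw [← abs_neg_eq]
  calc ‖intervalSum N u‖ ≤ 2 / (4 * |((-u).valMinAbs : ℝ)| / q) := by
        rw [geometric, norm_div]
        gcongr
    _ = (q / |((-u).valMinAbs : ℝ)|) / 2 := by field_simp; norm_num
    _ ≤ q / |((-u).valMinAbs : ℝ)| := half_le_self (by positivity)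

end Fourier

section Weights

variable {q : ℕ} [NeZero q]

/-- The upper bound for the Fourier coefficient `intervalSum N u` coming from the trivial bound at
`u = 0` and from summing the geometric series at `u ≠ 0`. -/
noncomputable def freqWeight (N : ℕ) (u : ZMod q) : ℝ :=
  if u = 0 then N else q / u.valMinAbs.natAbs

omit [NeZero q] in
theorem freqWeight_nonneg (N : ℕ) (u : ZMod q) : 0 ≤ freqWeight N u := by
  unfold freqWeight
  split_ifs <;> positivity

theorem norm_intervalSum_le_freqWeight (N : ℕ) (u : ZMod q) :
    ‖intervalSum N u‖ ≤ freqWeight N u := by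
  by_cases hu : u = 0
  · simpa only [freqWeight, if_pos hu] using norm_intervalSum_le N u
  · rw [freqWeight, if_neg hu, Nat.cast_natAbs, Int.cast_abs]
    exact norm_intervalSum_le_div N hu

theorem sum_natAbs_valMinAbs_le {G : ℕ → ℝ} (hG : ∀ n, 0 ≤ G n) :
    ∑ u : ZMod q with u ≠ 0, G u.valMinAbs.natAbs ≤ 2 * ∑ n ∈ Icc 1 q, G n := by
  have maps : ∀ u ∈ ({u | u ≠ 0} : Finset (ZMod q)), u.valMinAbs.natAbs ∈ Icc 1 q := by
    intro u hu
    rw [mem_Icc, Nat.one_le_iff_ne_zero, Ne, Int.natAbs_eq_zero, ZMod.valMinAbs_eq_zero]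
    exact ⟨(mem_filter.mp hu).2, (ZMod.natAbs_valMinAbs_le u).trans (Nat.div_le_self q 2)⟩
  rw [← sum_fiberwise_of_maps_to maps, mul_sum]
  refine sum_le_sum fun n _ => ?_
  rw [sum_congr rfl fun u hu => by rw [(mem_filter.mp hu).2], sum_const, nsmul_eq_mul]
  refine mul_le_mul_of_nonneg_right ?_ (hG n)
  have fiber : ({u ∈ ({u | u ≠ 0} : Finset (ZMod q)) | u.valMinAbs.natAbs = n}) ⊆
      {(n : ZMod q), -(n : ZMod q)} := by
    intro u hu
    rw [mem_insert, mem_singleton, ← (mem_filter.mp hu).2]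
    rcases Int.natAbs_eq u.valMinAbs with h | h
    · left
      rw [← Int.cast_natCast, ← h, ZMod.coe_valMinAbs]
    · right
      rw [← Int.cast_natCast, ← Int.cast_neg, ← h, ZMod.coe_valMinAbs]
  exact_mod_cast (card_le_card fiber).trans card_le_two

theorem sum_freqWeight_le (N : ℕ) :
    ∑ u : ZMod q, freqWeight N u ≤ N + 2 * q * (1 + Real.log q) := by
  have nonzero : ∑ u : ZMod q with u ≠ 0, freqWeight N u ≤ 2 * q * (1 + Real.log q) :=
    calc ∑ u : ZMod q with u ≠ 0, freqWeight N u
        = ∑ u : ZMod q with u ≠ 0, (q : ℝ) * (u.valMinAbs.natAbs : ℝ)⁻¹ :=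
          sum_congr rfl fun u hu => by
            rw [freqWeight, if_neg (mem_filter.mp hu).2, div_eq_mul_inv]
      _ ≤ 2 * ∑ n ∈ Icc 1 q, (q : ℝ) * (n : ℝ)⁻¹ :=
          sum_natAbs_valMinAbs_le (G := fun n => (q : ℝ) * (n : ℝ)⁻¹) fun n => by positivity
      _ = 2 * q * (harmonic q : ℚ) := by
          rw [← mul_sum, harmonic_eq_sum_Icc]
          push_cast
          ring
      _ ≤ 2 * q * (1 + Real.log q) := by
          gcongr
          exact harmonic_le_one_add_log q
  rw [← add_sum_erase _ _ (mem_univ (0 : ZMod q)), ← filter_ne', freqWeight, if_pos rfl]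
  gcongr

end Weights

section DominantCoordinates

theorem exists_dominant_coord {ι : Type*} [Fintype ι] {v : ι → ℤ} (hv : v ≠ 0) {d : ℤ}
    (hd : d ∣ v ⬝ᵥ v) : ∃ i, v i ≠ 0 ∧ d ≤ Fintype.card ι * v i ^ 2 := by
  obtain ⟨i₀, hi₀⟩ := Function.ne_iff.mp hv
  obtain ⟨i, -, hi⟩ := exists_max_image univ (fun i => v i ^ 2) ⟨i₀, mem_univ i₀⟩
  have sq_pos : 0 < v i ^ 2 := (sq_pos_iff.mpr hi₀).trans_le (hi i₀ (mem_univ i₀))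
  have norm_pos : 0 < v ⬝ᵥ v :=
    sum_pos' (fun i _ => mul_self_nonneg (v i)) ⟨i₀, mem_univ i₀, mul_self_pos.mpr hi₀⟩
  refine ⟨i, fun h => by simp [h] at sq_pos, ?_⟩
  calc d ≤ ∑ m, v m * v m := Int.le_of_dvd norm_pos hd
    _ ≤ ∑ _m : ι, v i ^ 2 := sum_le_sum fun m hm => by simpa only [sq] using hi m hm
    _ = Fintype.card ι * v i ^ 2 := by rw [sum_const, nsmul_eq_mul, card_univ]

/-- The conditions that a pair `j`, `g` satisfying `IsResonant` for a frequency vector in `ℤ ^ 3`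
imposes on its largest coordinate `w`, where `c` is the sum of the squares of the other two. -/
def IsDominantCoord (j g : ℕ) (c w : ℤ) : Prop :=
  (j : ℤ) ∣ w ∧ (j : ℤ) ^ 2 * g ∣ w ^ 2 + c ∧ (j : ℤ) ^ 2 * g ≤ 3 * w ^ 2

theorem isDominantCoord_natAbs {j g : ℕ} {c w : ℤ} :
    IsDominantCoord j g c (w.natAbs : ℤ) ↔ IsDominantCoord j g c w := by
  simp only [IsDominantCoord, Int.natCast_natAbs, dvd_abs, sq_abs]

theorem isDominantCoord_mul {j g : ℕ} (hj : j ≠ 0) {c : ℤ} {m : ℕ} :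
    IsDominantCoord j g ((j : ℤ) ^ 2 * c) ((j * m : ℕ) : ℤ) ↔
      (g : ℤ) ∣ (m : ℤ) ^ 2 + c ∧ g ≤ 3 * m ^ 2 := by
  have hj2 : (0 : ℤ) < (j : ℤ) ^ 2 := by positivity
  rw [IsDominantCoord, Nat.cast_mul, mul_pow, ← mul_add, mul_dvd_mul_iff_left hj2.ne',
    mul_left_comm 3, mul_le_mul_iff_right₀ hj2]
  norm_cast
  exact and_iff_right (dvd_mul_right _ _)

open Classical in
theorem sum_inv_isDominantCoord_le {j g : ℕ} (hj : 0 < j) (hg : 0 < g) (X : ℕ) (c : ℤ) :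
    ∑ n ∈ (Icc 1 X).filter fun n : ℕ => IsDominantCoord j g ((j : ℤ) ^ 2 * c) n, (1 : ℝ) / n ≤
      1 / j * (#g.divisors * ((3 + Real.log X) / √g)) := by
  have subset_image : ((Icc 1 X).filter fun n : ℕ => IsDominantCoord j g ((j : ℤ) ^ 2 * c) n) ⊆
      ((Icc 1 X).filter fun m : ℕ => (g : ℤ) ∣ (m : ℤ) ^ 2 + c ∧ g ≤ 3 * m ^ 2).image (j * ·) := by
    intro n hn
    obtain ⟨hnX, hdom⟩ := mem_filter.mp hn
    obtain ⟨m, rfl⟩ := Int.natCast_dvd_natCast.mp hdom.1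
    obtain ⟨pos, le⟩ := mem_Icc.mp hnX
    refine mem_image.mpr ⟨m, mem_filter.mpr ⟨mem_Icc.mpr ⟨?_, ?_⟩, ?_⟩, rfl⟩
    · exact Nat.pos_of_mul_pos_left pos
    · exact (Nat.le_mul_of_pos_left m hj).trans le
    · exact (isDominantCoord_mul hj.ne').mp hdom
  calc _ ≤ ∑ n ∈ ((Icc 1 X).filter fun m : ℕ =>
          (g : ℤ) ∣ (m : ℤ) ^ 2 + c ∧ g ≤ 3 * m ^ 2).image (j * ·), (1 : ℝ) / n :=
        sum_le_sum_of_subset_of_nonneg subset_image fun n _ _ => by positivity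
    _ = 1 / j * ∑ m ∈ (Icc 1 X).filter fun m : ℕ =>
          (g : ℤ) ∣ (m : ℤ) ^ 2 + c ∧ g ≤ 3 * m ^ 2, (1 : ℝ) / m := by
        rw [sum_image (mul_right_injective₀ hj.ne').injOn, mul_sum]
        refine sum_congr rfl fun m _ => ?_
        rw [Nat.cast_mul, one_div_mul_one_div]
    _ ≤ _ := by
        gcongr
        exact sum_inv_roots_le hg X c

variable {q : ℕ} [NeZero q]

open Classical in
theorem sum_freqWeight_isDominantCoord_le (N : ℕ) {j g : ℕ} (hj : 0 < j) (hg : 0 < g) (c : ℤ) :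
    ∑ w : ZMod q with w ≠ 0 ∧ IsDominantCoord j g ((j : ℤ) ^ 2 * c) w.valMinAbs, freqWeight N w ≤
      2 * (q / j * (#g.divisors * ((3 + Real.log q) / √g))) := by
  set P : ℕ → Prop := fun n => IsDominantCoord j g ((j : ℤ) ^ 2 * c) n with hP
  calc _ = ∑ w : ZMod q with w ≠ 0,
          (fun n : ℕ => if P n then (q : ℝ) * (1 / n) else 0) w.valMinAbs.natAbs := by
        rw [← filter_filter, sum_filter]
        refine sum_congr rfl fun w hw => ?_
        simp only [hP, isDominantCoord_natAbs, freqWeight, if_neg (mem_filter.mp hw).2, mul_one_div]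
    _ ≤ 2 * ∑ n ∈ Icc 1 q, (if P n then (q : ℝ) * (1 / n) else 0) :=
        sum_natAbs_valMinAbs_le (G := fun n => if P n then (q : ℝ) * (1 / n) else 0)
          fun n => by positivity
    _ = 2 * (q * ∑ n ∈ (Icc 1 q).filter P, (1 : ℝ) / n) := by rw [← sum_filter, ← mul_sum]
    _ ≤ 2 * (q * (1 / j * (#g.divisors * ((3 + Real.log q) / √g)))) := by
        gcongr
        exact sum_inv_isDominantCoord_le hj hg q c
    _ = _ := by ring

open Classical in
theorem sum_freqWeight_fiber_le (N : ℕ) {j g : ℕ} (hj : 0 < j) (hg : 0 < g) {n : ℕ}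
    (v : Fin n → ℤ) :
    ∑ w : ZMod q with w ≠ 0 ∧ (∀ m, (j : ℤ) ∣ v m) ∧ IsDominantCoord j g (v ⬝ᵥ v) w.valMinAbs,
      freqWeight N w ≤ 2 * (q / j * (#g.divisors * ((3 + Real.log q) / √g))) := by
  by_cases hv : ∀ m, (j : ℤ) ∣ v m
  · choose v' hv' using hv
    obtain rfl : v = (j : ℤ) • v' := funext hv'
    have norm_eq : ((j : ℤ) • v') ⬝ᵥ ((j : ℤ) • v') = (j : ℤ) ^ 2 * (v' ⬝ᵥ v') := by
      rw [smul_dotProduct, dotProduct_smul, smul_smul, smul_eq_mul, sq]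
    simpa only [norm_eq, Pi.smul_apply, smul_eq_mul, dvd_mul_right, implies_true, true_and] using
      sum_freqWeight_isDominantCoord_le N hj hg (v' ⬝ᵥ v')
  · have := Real.log_natCast_nonneg q
    simp only [hv, false_and, and_false, filter_false, sum_empty]
    positivity

open Classical in
theorem sum_prod_freqWeight_isDominantCoord_le (N : ℕ) {j g : ℕ} (hj : 0 < j) (hg : 0 < g) {n : ℕ}
    (i : Fin (n + 1)) :
    ∑ u : Fin (n + 1) → ZMod q with u i ≠ 0 ∧
        (∀ m, (j : ℤ) ∣ (u (i.succAbove m)).valMinAbs) ∧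
        IsDominantCoord j g ((fun m => (u (i.succAbove m)).valMinAbs) ⬝ᵥ
          fun m => (u (i.succAbove m)).valMinAbs) (u i).valMinAbs, ∏ m, freqWeight N (u m) ≤
      (N + 2 * q * (1 + Real.log q)) ^ n *
        (2 * (q / j * (#g.divisors * ((3 + Real.log q) / √g)))) := by
  have := Real.log_natCast_nonneg q
  calc _ = ∑ v : Fin n → ZMod q, (∏ m, freqWeight N (v m)) *
        ∑ w : ZMod q with w ≠ 0 ∧ (∀ m, (j : ℤ) ∣ (v m).valMinAbs) ∧ IsDominantCoord j g
          ((fun m => (v m).valMinAbs) ⬝ᵥ fun m => (v m).valMinAbs) w.valMinAbs,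
          freqWeight N w := by
        rw [sum_filter, ← (Fin.insertNthEquiv (fun _ => ZMod q) i).sum_comp,
          Fintype.sum_prod_type_right]
        simp only [Fin.insertNthEquiv_apply, Fin.insertNth_apply_same, Fin.prod_univ_succAbove _ i,
          Fin.insertNth_apply_succAbove, mul_sum, sum_filter, mul_ite, mul_zero,
          mul_comm (freqWeight N _)]
    _ ≤ ∑ v : Fin n → ZMod q, (∏ m, freqWeight N (v m)) *
          (2 * (q / j * (#g.divisors * ((3 + Real.log q) / √g)))) :=
        sum_le_sum fun v _ => mul_le_mul_of_nonneg_left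
          (sum_freqWeight_fiber_le N hj hg fun m => (v m).valMinAbs)
          (prod_nonneg fun m _ => freqWeight_nonneg N (v m))
    _ = (∑ w : ZMod q, freqWeight N w) ^ n *
          (2 * (q / j * (#g.divisors * ((3 + Real.log q) / √g)))) := by
        rw [← sum_mul, Fintype.sum_pow]
    _ ≤ _ := mul_le_mul_of_nonneg_right
        (pow_le_pow_left₀ (sum_nonneg fun w _ => freqWeight_nonneg N w) (sum_freqWeight_le N) n)
        (by positivity)

theorem IsResonant.isDominantCoord {n j g : ℕ} {v : Fin (n + 1) → ℤ} (hv : IsResonant j g v)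
    {i : Fin (n + 1)} (hi : (j : ℤ) ^ 2 * g ≤ 3 * v i ^ 2) :
    IsDominantCoord j g ((fun m => v (i.succAbove m)) ⬝ᵥ fun m => v (i.succAbove m)) (v i) := by
  refine ⟨hv.1 i, ?_, hi⟩
  have h := hv.2
  rwa [dotProduct, Fin.sum_univ_succAbove _ i, ← sq] at h

open Classical in
theorem sum_prod_freqWeight_resonant_le (N : ℕ) {j g : ℕ} (hj : 0 < j) (hg : 0 < g) :
    ∑ u : Fin 3 → ZMod q with u ≠ 0 ∧ IsResonant j g (fun m => (u m).valMinAbs),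
        ∏ m, freqWeight N (u m) ≤
      3 * ((N + 2 * q * (1 + Real.log q)) ^ 2 *
        (2 * (q / j * (#g.divisors * ((3 + Real.log q) / √g))))) := by
  set dominant : Fin 3 → (Fin 3 → ZMod q) → Prop := fun i u => u i ≠ 0 ∧
    (∀ m, (j : ℤ) ∣ (u (i.succAbove m)).valMinAbs) ∧
    IsDominantCoord j g ((fun m => (u (i.succAbove m)).valMinAbs) ⬝ᵥ
      fun m => (u (i.succAbove m)).valMinAbs) (u i).valMinAbs
  have exists_dominant {u : Fin 3 → ZMod q} (hu : u ≠ 0)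
      (hres : IsResonant j g (fun m => (u m).valMinAbs)) : ∃ i, dominant i u := by
    have lift_ne_zero : (fun m => (u m).valMinAbs) ≠ 0 := fun h =>
      hu (funext fun m => (ZMod.valMinAbs_eq_zero _).mp (congrFun h m))
    obtain ⟨i, hi0, hi⟩ := exists_dominant_coord lift_ne_zero hres.2
    exact ⟨i, mt (ZMod.valMinAbs_eq_zero _).mpr hi0, fun m => hres.1 _,
      hres.isDominantCoord (by simpa only [Fintype.card_fin, Nat.cast_ofNat] using hi)⟩
  have weight_nonneg (u : Fin 3 → ZMod q) : 0 ≤ ∏ m, freqWeight N (u m) :=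
    prod_nonneg fun m _ => freqWeight_nonneg N (u m)
  calc _ ≤ ∑ u : Fin 3 → ZMod q, ∑ i, if dominant i u then ∏ m, freqWeight N (u m) else 0 := by
        rw [sum_filter]
        refine sum_le_sum fun u _ => ?_
        have terms_nonneg (i : Fin 3) : 0 ≤ if dominant i u then ∏ m, freqWeight N (u m) else 0 :=
          ite_nonneg (weight_nonneg u) le_rfl
        split_ifs with hu
        · obtain ⟨i, hi⟩ := exists_dominant hu.1 hu.2
          exact (if_pos hi).ge.trans (single_le_sum (fun i _ => terms_nonneg i) (mem_univ i))
        · exact sum_nonneg fun i _ => terms_nonneg i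
    _ = ∑ i, ∑ u : Fin 3 → ZMod q with dominant i u, ∏ m, freqWeight N (u m) := by
        rw [sum_comm]
        simp only [sum_filter]
    _ ≤ #(univ : Finset (Fin 3)) • _ :=
        sum_le_card_nsmul _ _ _ fun i _ => sum_prod_freqWeight_isDominantCoord_le N hj hg i
    _ = _ := by rw [nsmul_eq_mul, card_univ, Fintype.card_fin, Nat.cast_ofNat]

end DominantCoordinates

section CountError

variable {q : ℕ} [NeZero q] {k : ℤ} {K : ℝ}

theorem cube_mul_divCount_sub_eq_sum (N : ℕ) (k : ℤ) :
    (q : ℂ) ^ 3 * (divCount N q k - (N : ℂ) ^ 3 * (lam q k / (q : ℂ) ^ 3)) =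
      ∑ u : Fin 3 → ZMod q with u ≠ 0,
        quadricSum ZMod.stdAddChar (k : ZMod q) u * ∏ i, intervalSum N (u i) := by
  have hq : (q : ℂ) ≠ 0 := by exact_mod_cast NeZero.ne q
  have zero_freq : quadricSum ZMod.stdAddChar (k : ZMod q) (0 : Fin 3 → ZMod q) *
      ∏ i : Fin 3, intervalSum N ((0 : Fin 3 → ZMod q) i) = lam q k * (N : ℂ) ^ 3 := by
    have interval_zero : intervalSum N (0 : ZMod q) = N := by simp [intervalSum]
    simp only [lam_eq_quadricSum, Int.cast_zero, Pi.zero_apply, interval_zero, prod_const,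
      card_univ, Fintype.card_fin]
    rfl
  rw [filter_ne', sum_erase_eq_sub (mem_univ _), ← divCount_eq_sum, zero_freq]
  field_simp

/-- The factor `j * √g` lost in the exponential sum is regained from the sparsity of the frequencies
that are resonant for `j` and `g`. -/
theorem sum_norm_mul_freqWeight_le_of_isResonant (N : ℕ) (hK : 0 ≤ K) {j g : ℕ}
    (hj : j ∈ q.divisors) (hg : g ∈ q.divisors) {s : Finset (Fin 3 → ZMod q)}
    (hs : ∀ u ∈ s, u ≠ 0 ∧ IsResonant j g (fun m => (u m).valMinAbs) ∧
      ‖quadricSum ZMod.stdAddChar (k : ZMod q) u‖ ≤ K * q * (j * √g)) :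
    ∑ u ∈ s, ‖quadricSum ZMod.stdAddChar (k : ZMod q) u‖ * ∏ m, freqWeight N (u m) ≤
      6 * K * #q.divisors * (3 + Real.log q) * q ^ 2 * (N + 2 * q * (1 + Real.log q)) ^ 2 := by
  classical
  have := Real.log_natCast_nonneg q
  have hj0 : 0 < j := Nat.pos_of_mem_divisors hj
  have hg0 : 0 < g := Nat.pos_of_mem_divisors hg
  have card_le : #g.divisors ≤ #q.divisors :=
    card_le_card (Nat.divisors_subset_of_dvd (NeZero.ne q) (Nat.dvd_of_mem_divisors hg))
  have weight_nonneg (u : Fin 3 → ZMod q) : 0 ≤ ∏ m, freqWeight N (u m) :=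
    prod_nonneg fun m _ => freqWeight_nonneg N (u m)
  calc _ ≤ ∑ u ∈ s, K * q * (j * √g) * ∏ m, freqWeight N (u m) :=
        sum_le_sum fun u hu => mul_le_mul_of_nonneg_right (hs u hu).2.2 (weight_nonneg u)
    _ ≤ ∑ u : Fin 3 → ZMod q with u ≠ 0 ∧ IsResonant j g (fun m => (u m).valMinAbs),
          K * q * (j * √g) * ∏ m, freqWeight N (u m) :=
        sum_le_sum_of_subset_of_nonneg
          (fun u hu => mem_filter.mpr ⟨mem_univ u, (hs u hu).1, (hs u hu).2.1⟩)
          fun u _ _ => mul_nonneg (by positivity) (weight_nonneg u)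
    _ ≤ K * q * (j * √g) * (3 * ((N + 2 * q * (1 + Real.log q)) ^ 2 *
          (2 * (q / j * (#g.divisors * ((3 + Real.log q) / √g)))))) := by
        rw [← mul_sum]
        gcongr
        exact sum_prod_freqWeight_resonant_le N hj0 hg0
    _ = 6 * K * #g.divisors * (3 + Real.log q) * q ^ 2 *
          (N + 2 * q * (1 + Real.log q)) ^ 2 := by
        field_simp
        ring
    _ ≤ _ := by gcongr

theorem QuadricSumBound.sum_norm_mul_freqWeight_le (hK : 0 ≤ K) (h : QuadricSumBound q k K)
    (N : ℕ) :
    ∑ u : Fin 3 → ZMod q with u ≠ 0,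
        ‖quadricSum ZMod.stdAddChar (k : ZMod q) u‖ * ∏ m, freqWeight N (u m) ≤
      6 * K * #q.divisors ^ 3 * (3 + Real.log q) * q ^ 2 *
        (N + 2 * q * (1 + Real.log q)) ^ 2 := by
  choose J G hJG hres hbound using fun u : Fin 3 → ZMod q => h fun m => (u m).valMinAbs
  simp only [ZMod.coe_valMinAbs] at hbound
  have maps (u : Fin 3 → ZMod q) (_ : u ∈ ({u | u ≠ 0} : Finset (Fin 3 → ZMod q))) :
      (J u, G u) ∈ q.divisors ×ˢ q.divisors :=
    mem_product.mpr ⟨Nat.mem_divisors.mpr ⟨(dvd_mul_right _ _).trans (hJG u), NeZero.ne q⟩,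
      Nat.mem_divisors.mpr ⟨(dvd_mul_left _ _).trans (hJG u), NeZero.ne q⟩⟩
  rw [← sum_fiberwise_of_maps_to maps]
  calc _ ≤ #(q.divisors ×ˢ q.divisors) • (6 * K * #q.divisors * (3 + Real.log q) * q ^ 2 *
          (N + 2 * q * (1 + Real.log q)) ^ 2) := by
        refine sum_le_card_nsmul _ _ _ fun i hi => ?_
        refine sum_norm_mul_freqWeight_le_of_isResonant N hK (mem_product.mp hi).1
          (mem_product.mp hi).2 fun u hu => ?_
        obtain ⟨hu0, rfl⟩ := mem_filter.mp hu
        exact ⟨(mem_filter.mp hu0).2, hres u, hbound u⟩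
    _ = _ := by
        rw [nsmul_eq_mul, card_product, Nat.cast_mul]
        ring

theorem QuadricSumBound.abs_divCount_sub_le (hK : 0 ≤ K) (h : QuadricSumBound q k K) (N : ℕ) :
    |(divCount N q k : ℝ) - (N : ℝ) ^ 3 * (lam q k / (q : ℝ) ^ 3)| ≤
      24 * K * #q.divisors ^ 3 * (3 + Real.log q) ^ 3 * ((N + q) ^ 2 / q) := by
  have hq : (0 : ℝ) < q := by exact_mod_cast NeZero.pos q
  have hlog := Real.log_natCast_nonneg q
  have total_weight_le : (N : ℝ) + 2 * q * (1 + Real.log q) ≤ 2 * (3 + Real.log q) * (N + q) := by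
    nlinarith [mul_nonneg hlog N.cast_nonneg, mul_nonneg hlog hq.le, (N.cast_nonneg : (0 : ℝ) ≤ N)]
  refine le_of_mul_le_mul_left ?_ (pow_pos hq 3)
  calc (q : ℝ) ^ 3 * |(divCount N q k : ℝ) - (N : ℝ) ^ 3 * (lam q k / (q : ℝ) ^ 3)|
      = ‖(q : ℂ) ^ 3 * (divCount N q k - (N : ℂ) ^ 3 * (lam q k / (q : ℂ) ^ 3))‖ := by
        rw [norm_mul, norm_pow, Complex.norm_natCast, ← Real.norm_eq_abs, ← Complex.norm_real]
        push_cast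
        rfl
    _ ≤ ∑ u : Fin 3 → ZMod q with u ≠ 0,
          ‖quadricSum ZMod.stdAddChar (k : ZMod q) u‖ * ∏ m, freqWeight N (u m) := by
        rw [cube_mul_divCount_sub_eq_sum]
        refine norm_sum_le_of_le _ fun u _ => ?_
        rw [norm_mul, norm_prod]
        gcongr
        exact norm_intervalSum_le_freqWeight N _
    _ ≤ 6 * K * #q.divisors ^ 3 * (3 + Real.log q) * q ^ 2 *
          (N + 2 * q * (1 + Real.log q)) ^ 2 := h.sum_norm_mul_freqWeight_le hK N
    _ ≤ 6 * K * #q.divisors ^ 3 * (3 + Real.log q) * q ^ 2 *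
          (2 * (3 + Real.log q) * (N + q)) ^ 2 := by gcongr
    _ = (q : ℝ) ^ 3 *
          (24 * K * #q.divisors ^ 3 * (3 + Real.log q) ^ 3 * ((N + q) ^ 2 / q)) := by
        field_simp
        ring

end CountError

section UniformBounds

theorem three_add_log_le {x δ : ℝ} (hx : 1 ≤ x) (hδ : 0 < δ) :
    3 + Real.log x ≤ (3 + 1 / δ) * x ^ δ := by
  have log_le := Real.log_le_rpow_div (zero_le_one.trans hx) hδ
  have one_le := Real.one_le_rpow hx hδ.le
  rw [add_mul, one_div_mul_eq_div]
  linarith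

theorem exists_divisors_mul_log_le {η : ℝ} (hη : 0 < η) :
    ∃ C : ℝ, 0 ≤ C ∧ ∀ q : ℕ, q ≠ 0 →
      (#q.divisors : ℝ) ^ 3 * (3 + Real.log q) ^ 3 ≤ C * (q : ℝ) ^ η := by
  have hδ : 0 < η / 6 := by positivity
  obtain ⟨C, hC, hdiv⟩ := exists_card_divisors_le hδ
  refine ⟨(C * (3 + 1 / (η / 6))) ^ 3, by positivity, fun q hq => ?_⟩
  have hq1 : (1 : ℝ) ≤ q := by exact_mod_cast Nat.one_le_iff_ne_zero.mpr hq
  have : 0 ≤ Real.log q := Real.log_nonneg hq1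
  have rpow_six : (q : ℝ) ^ η = ((q : ℝ) ^ (η / 6)) ^ 6 := by
    rw [← Real.rpow_mul_natCast (by positivity)]
    congr 1
    push_cast
    ring
  calc (#q.divisors : ℝ) ^ 3 * (3 + Real.log q) ^ 3
      ≤ (C * (q : ℝ) ^ (η / 6)) ^ 3 * ((3 + 1 / (η / 6)) * (q : ℝ) ^ (η / 6)) ^ 3 := by
        gcongr
        exacts [hdiv q hq, three_add_log_le hq1 hδ]
    _ = _ := by
        rw [rpow_six]
        ring

theorem exists_divCount_error_le {r : ℕ} (hr : r ≠ 0) (k : ℤ) {η : ℝ} (hη : 0 < η) :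
    ∃ C : ℝ, 0 ≤ C ∧ ∀ d : ℕ, Squarefree d → ∀ N : ℕ,
      |(divCount N (d ^ r) k : ℝ) - (N : ℝ) ^ 3 * (lam (d ^ r) k / ((d ^ r : ℕ) : ℝ) ^ 3)| ≤
        C * (d : ℝ) ^ η * ((N : ℝ) ^ 2 / (d : ℝ) ^ r + (d : ℝ) ^ r) := by
  obtain ⟨A, hA, hbound⟩ := exists_quadricSumBound r k
  obtain ⟨C₁, hC₁, omega_le⟩ := exists_pow_card_primeFactors_le hA (half_pos hη)
  obtain ⟨C₂, hC₂, divisors_le⟩ := exists_divisors_mul_log_le (show 0 < η / 2 / r by positivity)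
  refine ⟨48 * C₁ * C₂, by positivity, fun d hd N => ?_⟩
  have : NeZero (d ^ r) := ⟨pow_ne_zero r hd.ne_zero⟩
  have hd0 : (0 : ℝ) < d := by exact_mod_cast Nat.pos_of_ne_zero hd.ne_zero
  have hA0 : 0 ≤ A ^ #d.primeFactors := by positivity
  have rpow_root : ((d ^ r : ℕ) : ℝ) ^ (η / 2 / r) = (d : ℝ) ^ (η / 2) := by
    rw [Nat.cast_pow, ← Real.rpow_natCast_mul hd0.le]
    congr 1
    field_simp
  have divisors_le' := divisors_le (d ^ r) (NeZero.ne _)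
  rw [rpow_root] at divisors_le'
  have hrpow : (d : ℝ) ^ η = (d : ℝ) ^ (η / 2) * (d : ℝ) ^ (η / 2) := by
    rw [← Real.rpow_add hd0, add_halves]
  calc _ ≤ _ := (hbound d hd).abs_divCount_sub_le hA0 N
    _ = 24 * A ^ #d.primeFactors * (#(d ^ r).divisors ^ 3 * (3 + Real.log (d ^ r : ℕ)) ^ 3) *
        ((N + (d ^ r : ℕ)) ^ 2 / (d ^ r : ℕ)) := by ring
    _ ≤ 24 * (C₁ * (d : ℝ) ^ (η / 2)) * (C₂ * (d : ℝ) ^ (η / 2)) *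
        ((N + (d ^ r : ℕ)) ^ 2 / (d ^ r : ℕ)) := by
        gcongr
        exact omega_le d hd.ne_zero
    _ ≤ 24 * (C₁ * (d : ℝ) ^ (η / 2)) * (C₂ * (d : ℝ) ^ (η / 2)) *
        (2 * ((N : ℝ) ^ 2 + (d ^ r : ℕ) ^ 2) / (d ^ r : ℕ)) := by
        gcongr
        exact add_sq_le
    _ = _ := by
        rw [hrpow]
        push_cast
        field_simp
        ring

theorem exists_lam_le (r : ℕ) (k : ℤ) {η : ℝ} (hη : 0 < η) :
    ∃ C : ℝ, 0 ≤ C ∧ ∀ d : ℕ, Squarefree d →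
      (lam (d ^ r) k : ℝ) / ((d ^ r : ℕ) : ℝ) ^ 3 ≤ C * (d : ℝ) ^ (η - r) := by
  obtain ⟨A, hA, hbound⟩ := exists_quadricSumBound r k
  obtain ⟨C, hC, omega_le⟩ := exists_pow_card_primeFactors_le hA hη
  refine ⟨C, hC.le, fun d hd => ?_⟩
  have : NeZero (d ^ r) := ⟨pow_ne_zero r hd.ne_zero⟩
  have hd0 : (0 : ℝ) < d := by exact_mod_cast Nat.pos_of_ne_zero hd.ne_zero
  have lam_le := (hbound d hd).lam_le (by positivity)
  push_cast at lam_le ⊢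
  rw [div_le_iff₀ (by positivity), Real.rpow_sub hd0, Real.rpow_natCast]
  calc (lam (d ^ r) k : ℝ) ≤ A ^ #d.primeFactors * ((d : ℝ) ^ r) ^ 2 := lam_le
    _ ≤ C * (d : ℝ) ^ η * ((d : ℝ) ^ r) ^ 2 := by gcongr; exact omega_le d hd.ne_zero
    _ = _ := by field_simp

end UniformBounds

section NonzeroMultiples

theorem natAbs_sum_sq_add_le {N : ℕ} {x : Fin 3 → ℕ}
    (hx : x ∈ Fintype.piFinset fun _ => Icc 1 N) (k : ℤ) :
    (∑ i, (x i : ℤ) ^ 2 + k).natAbs ≤ 3 * N ^ 2 + k.natAbs := by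
  have hxN : ∀ i, x i ≤ N := fun i => (mem_Icc.mp (Fintype.mem_piFinset.mp hx i)).2
  refine (Int.natAbs_add_le _ _).trans (Nat.add_le_add_right ?_ _)
  calc (∑ i, (x i : ℤ) ^ 2).natAbs = ∑ i, x i ^ 2 := by exact_mod_cast Int.natAbs_natCast _
    _ ≤ ∑ _i : Fin 3, N ^ 2 := sum_le_sum fun i _ => Nat.pow_le_pow_left (hxN i) 2
    _ = 3 * N ^ 2 := by simp

theorem exists_card_sq_add_sq_eq_le {η : ℝ} (hη : 0 < η) :
    ∃ C : ℝ, 0 ≤ C ∧ ∀ N : ℕ, ∀ n : ℤ,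
      (#{t ∈ Icc 1 N ×ˢ Icc 1 N | (t.1 : ℤ) ^ 2 + (t.2 : ℤ) ^ 2 = n} : ℝ) ≤ C * (N : ℝ) ^ η := by
  obtain ⟨C, hC, divisors_le⟩ := exists_card_divisors_le (show 0 < η / 4 by positivity)
  refine ⟨(C * 2 ^ (η / 4)) ^ 2, by positivity, fun N n => ?_⟩
  set S := {t ∈ Icc 1 N ×ˢ Icc 1 N | (t.1 : ℤ) ^ 2 + (t.2 : ℤ) ^ 2 = n} with hS
  rcases S.eq_empty_or_nonempty with hempty | ⟨⟨a, b⟩, hab⟩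
  · rw [hempty, card_empty, Nat.cast_zero]
    positivity
  simp only [hS, mem_filter, mem_product, mem_Icc] at hab
  obtain ⟨⟨⟨ha, haN⟩, -, hbN⟩, rfl⟩ := hab
  have hne : a ^ 2 + b ^ 2 ≠ 0 := by positivity
  have hle : a ^ 2 + b ^ 2 ≤ 2 * N ^ 2 := by
    rw [two_mul]
    gcongr
  have card_le : #S ≤ #(a ^ 2 + b ^ 2).divisors ^ 2 := by
    refine card_sq_add_sq_le hne fun t ht => ?_
    simp only [hS, mem_filter, mem_product, mem_Icc] at ht
    exact ⟨⟨ht.1.1.1, ht.1.2.1⟩, by exact_mod_cast ht.2⟩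
  calc (#S : ℝ) ≤ (#(a ^ 2 + b ^ 2).divisors : ℝ) ^ 2 := by exact_mod_cast card_le
    _ ≤ (C * ((a ^ 2 + b ^ 2 : ℕ) : ℝ) ^ (η / 4)) ^ 2 := by gcongr; exact divisors_le _ hne
    _ ≤ (C * (2 * (N : ℝ) ^ 2) ^ (η / 4)) ^ 2 := by gcongr; exact_mod_cast hle
    _ = (C * 2 ^ (η / 4)) ^ 2 * (N : ℝ) ^ η := by
        rw [Real.mul_rpow (by positivity) (by positivity), ← mul_assoc, mul_pow _ (_ ^ (η / 4)),
          ← Real.rpow_natCast_mul (by positivity), ← Real.rpow_mul_natCast (by positivity)]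
        congr 2
        push_cast
        ring

theorem exists_card_sum_sq_eq_le {η : ℝ} (hη : 0 < η) :
    ∃ C : ℝ, 0 ≤ C ∧ ∀ N : ℕ, ∀ n : ℤ,
      (#{x ∈ Fintype.piFinset fun _ : Fin 3 => Icc 1 N | ∑ i, (x i : ℤ) ^ 2 = n} : ℝ) ≤
        N * (C * (N : ℝ) ^ η) := by
  obtain ⟨C, hC, two_squares⟩ := exists_card_sq_add_sq_eq_le hη
  refine ⟨C, hC, fun N n => ?_⟩
  have fiberwise :
      #{x ∈ Fintype.piFinset fun _ : Fin 3 => Icc 1 N | ∑ i, (x i : ℤ) ^ 2 = n} =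
        ∑ a ∈ Icc 1 N,
          #{t ∈ Icc 1 N ×ˢ Icc 1 N | (t.1 : ℤ) ^ 2 + (t.2 : ℤ) ^ 2 = n - (a : ℤ) ^ 2} := by
    rw [← card_filter_product_eq_piFinset (Icc 1 N) fun x => ∑ i, (x i : ℤ) ^ 2 = n]
    simp only [card_filter, sum_product, Fin.sum_univ_three, Matrix.cons_val, eq_sub_iff_add_eq',
      add_assoc]
  rw [fiberwise, Nat.cast_sum]
  refine (sum_le_card_nsmul _ _ _ fun a _ => two_squares N _).trans_eq ?_
  rw [Nat.card_Icc, Nat.add_sub_cancel, nsmul_eq_mul]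

/-- The number of `x ∈ [1, N] ^ 3` for which `x₁ ^ 2 + x₂ ^ 2 + x₃ ^ 2 + k` is a nonzero multiple
of `q`; unlike `divCount` it can be summed over arbitrarily large `q`. -/
def nonzeroCount (N q : ℕ) (k : ℤ) : ℕ :=
  #{x ∈ Fintype.piFinset fun _ : Fin 3 => Icc 1 N |
    ∑ i, (x i : ℤ) ^ 2 + k ≠ 0 ∧ (q : ℤ) ∣ ∑ i, (x i : ℤ) ^ 2 + k}

/-- The number of `x ∈ [1, N] ^ 3` with `x₁ ^ 2 + x₂ ^ 2 + x₃ ^ 2 + k = 0`. -/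
def zeroCount (N : ℕ) (k : ℤ) : ℕ :=
  #{x ∈ Fintype.piFinset fun _ : Fin 3 => Icc 1 N | ∑ i, (x i : ℤ) ^ 2 + k = 0}

theorem divCount_eq_nonzeroCount_add (N q : ℕ) (k : ℤ) :
    divCount N q k = nonzeroCount N q k + zeroCount N k := by
  rw [divCount, ← card_filter_add_card_filter_not fun x : Fin 3 → ℕ => ∑ i, (x i : ℤ) ^ 2 + k ≠ 0,
    filter_filter, filter_filter, nonzeroCount, zeroCount]
  congr 2 <;> ext x <;> simp +contextual [and_comm]

theorem zeroCount_le (N : ℕ) (k : ℤ) : zeroCount N k ≤ (k.natAbs + 1) ^ 3 := by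
  calc zeroCount N k
      ≤ #(Fintype.piFinset fun _ : Fin 3 => range (k.natAbs + 1)) := by
        refine card_le_card fun x hx => Fintype.mem_piFinset.mpr fun i => mem_range_succ_iff.mpr ?_
        have sum_eq : ∑ j, x j ^ 2 = k.natAbs := by
          have := eq_neg_of_add_eq_zero_left (mem_filter.mp hx).2
          rw [← Int.natAbs_neg k, ← this]
          exact_mod_cast (Int.natAbs_natCast _).symm
        rw [← sum_eq]
        exact (Nat.le_self_pow two_ne_zero _).trans
          (single_le_sum_of_canonicallyOrdered (f := fun j => x j ^ 2) (mem_univ i))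
    _ = (k.natAbs + 1) ^ 3 := by simp

theorem exists_nonzeroCount_error_le {r : ℕ} (hr : r ≠ 0) (k : ℤ) {η : ℝ} (hη : 0 < η) :
    ∃ C : ℝ, 0 ≤ C ∧ ∀ d : ℕ, Squarefree d → ∀ N : ℕ,
      |(nonzeroCount N (d ^ r) k : ℝ) - (N : ℝ) ^ 3 * (lam (d ^ r) k / ((d ^ r : ℕ) : ℝ) ^ 3)| ≤
        C * (d : ℝ) ^ η * ((N : ℝ) ^ 2 / (d : ℝ) ^ r + (d : ℝ) ^ r) := by
  obtain ⟨C, hC, error_le⟩ := exists_divCount_error_le hr k hη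
  refine ⟨C + ((k.natAbs + 1 : ℕ) : ℝ) ^ 3, by positivity, fun d hd N => ?_⟩
  have hd1 : (1 : ℝ) ≤ d := by exact_mod_cast Nat.one_le_iff_ne_zero.mpr hd.ne_zero
  have zeros_le : (zeroCount N k : ℝ) ≤ ((k.natAbs + 1 : ℕ) : ℝ) ^ 3 := by
    exact_mod_cast zeroCount_le N k
  have one_le : 1 ≤ (d : ℝ) ^ η * ((N : ℝ) ^ 2 / (d : ℝ) ^ r + (d : ℝ) ^ r) :=
    one_le_mul_of_one_le_of_one_le (Real.one_le_rpow hd1 hη.le)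
      ((one_le_pow₀ hd1).trans (le_add_of_nonneg_left (by positivity)))
  have count_eq : (nonzeroCount N (d ^ r) k : ℝ) = divCount N (d ^ r) k - zeroCount N k := by
    rw [divCount_eq_nonzeroCount_add, Nat.cast_add, add_sub_cancel_right]
  rw [count_eq, sub_right_comm, add_mul, add_mul]
  refine (abs_sub _ _).trans (add_le_add (error_le d hd N) ?_)
  rw [Nat.abs_cast, mul_assoc]
  exact zeros_le.trans (le_mul_of_one_le_right (by positivity) one_le)

theorem nonzeroCount_eq_sum (N : ℕ) {q : ℕ} (hq : q ≠ 0) (k : ℤ) :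
    nonzeroCount N q k =
      ∑ m ∈ (Icc (-((3 * N ^ 2 + k.natAbs) / q : ℕ) : ℤ) ((3 * N ^ 2 + k.natAbs) / q : ℕ)).erase 0,
        #{x ∈ Fintype.piFinset fun _ : Fin 3 => Icc 1 N | ∑ i, (x i : ℤ) ^ 2 = q * m - k} := by
  have hqZ : (q : ℤ) ≠ 0 := by exact_mod_cast hq
  rw [nonzeroCount, card_eq_sum_card_fiberwise
    (f := fun x : Fin 3 → ℕ => (∑ i, (x i : ℤ) ^ 2 + k) / q)]
  · refine sum_congr rfl fun m hm => ?_
    rw [filter_filter]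
    congr 1 with x
    simp only [mem_filter, and_congr_right_iff, eq_sub_iff_add_eq]
    refine fun _ => ⟨fun ⟨⟨_, hdvd⟩, hdiv⟩ => ?_, fun h => ?_⟩
    · rw [← hdiv, Int.mul_ediv_cancel' hdvd]
    · rw [h, Int.mul_ediv_cancel_left _ hqZ]
      exact ⟨⟨mul_ne_zero hqZ (ne_of_mem_erase hm), dvd_mul_right _ _⟩, rfl⟩
  · intro x hx
    obtain ⟨hbox, hne, m, hm⟩ := mem_filter.mp hx
    have hle := natAbs_sum_sq_add_le hbox k
    simp only [hm, Int.mul_ediv_cancel_left _ hqZ, Int.natAbs_mul, Int.natAbs_natCast] at hle hne ⊢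
    have hmM : m.natAbs ≤ (3 * N ^ 2 + k.natAbs) / q :=
      (Nat.le_div_iff_mul_le (Nat.pos_of_ne_zero hq)).mpr (by rwa [mul_comm])
    refine mem_coe.mpr (mem_erase.mpr ⟨right_ne_zero_of_mul hne, mem_Icc.mpr ?_⟩)
    omega

theorem exists_nonzeroCount_le (k : ℤ) {η : ℝ} (hη : 0 < η) :
    ∃ C : ℝ, 0 ≤ C ∧ ∀ N q : ℕ, 1 ≤ N → q ≠ 0 →
      (nonzeroCount N q k : ℝ) ≤ C * (N : ℝ) ^ (3 + η) / q := by
  obtain ⟨C, hC, fiber_le⟩ := exists_card_sum_sq_eq_le hη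
  refine ⟨2 * (3 + k.natAbs) * C, by positivity, fun N q hN hq => ?_⟩
  have hN1 : (1 : ℝ) ≤ N := by exact_mod_cast hN
  set M := (3 * N ^ 2 + k.natAbs) / q with hM
  have card_multiples : #((Icc (-M : ℤ) M).erase 0) = 2 * M := by
    rw [card_erase_of_mem (by simp), Int.card_Icc]
    omega
  have M_le : (M : ℝ) ≤ (3 + k.natAbs) * (N : ℝ) ^ 2 / q := by
    refine Nat.cast_div_le.trans ?_
    push_cast
    rw [add_mul]
    gcongr
    exact le_mul_of_one_le_right (Nat.cast_nonneg _) (one_le_pow₀ hN1)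
  calc (nonzeroCount N q k : ℝ) ≤ #((Icc (-M : ℤ) M).erase 0) • (N * (C * (N : ℝ) ^ η)) := by
        rw [nonzeroCount_eq_sum N hq, ← hM, Nat.cast_sum]
        exact sum_le_card_nsmul _ _ _ fun m _ => fiber_le N _
    _ = 2 * M * (N * (C * (N : ℝ) ^ η)) := by
        rw [card_multiples, nsmul_eq_mul]
        push_cast
        rfl
    _ ≤ 2 * ((3 + k.natAbs) * (N : ℝ) ^ 2 / q) * (N * (C * (N : ℝ) ^ η)) := by gcongr
    _ = 2 * (3 + k.natAbs) * C * (N : ℝ) ^ (3 + η) / q := by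
        rw [Real.rpow_add (by positivity), show (3 : ℝ) = (3 : ℕ) by rfl, Real.rpow_natCast]
        push_cast
        ring

end NonzeroMultiples

section Moebius

open ArithmeticFunction

theorem natCast_pow_dvd_iff_dvd_floorRoot {r d : ℕ} {n : ℤ} :
    ((d ^ r : ℕ) : ℤ) ∣ n ↔ d ∣ Nat.floorRoot r n.natAbs := by
  rw [Int.natCast_dvd, Nat.pow_dvd_iff_dvd_floorRoot]

theorem isRFree_iff_floorRoot_eq_one {r : ℕ} {n : ℤ} :
    IsRFree r n ↔ Nat.floorRoot r n.natAbs = 1 := by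
  simp only [IsRFree, Nat.eq_one_iff_not_exists_prime_dvd, ← natCast_pow_dvd_iff_dvd_floorRoot,
    Nat.cast_pow]

theorem IsRFree.ne_zero {r : ℕ} {n : ℤ} (h : IsRFree r n) : n ≠ 0 := by
  rintro rfl
  exact h 2 Nat.prime_two (dvd_zero _)

theorem sum_moebius_pow_dvd {r : ℕ} (hr : r ≠ 0) {n : ℤ} (hn : n ≠ 0) {B : ℕ}
    (hB : n.natAbs ≤ B) [Decidable (IsRFree r n)] :
    ∑ d ∈ Icc 1 B with ((d ^ r : ℕ) : ℤ) ∣ n, moebius d = if IsRFree r n then 1 else 0 := by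
  have hn0 : n.natAbs ≠ 0 := Int.natAbs_ne_zero.mpr hn
  have root_ne_zero : Nat.floorRoot r n.natAbs ≠ 0 := Nat.floorRoot_ne_zero.mpr ⟨hr, hn0⟩
  have filter_eq : {d ∈ Icc 1 B | ((d ^ r : ℕ) : ℤ) ∣ n} = (Nat.floorRoot r n.natAbs).divisors := by
    ext d
    simp only [mem_filter, mem_Icc, Nat.mem_divisors, natCast_pow_dvd_iff_dvd_floorRoot]
    refine ⟨fun h => ⟨h.2, root_ne_zero⟩, fun ⟨h, _⟩ => ⟨⟨Nat.pos_of_dvd_of_pos h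
      (Nat.pos_of_ne_zero root_ne_zero), ?_⟩, h⟩⟩
    calc d ≤ d ^ r := Nat.le_self_pow hr d
      _ ≤ n.natAbs := Nat.le_of_dvd (Nat.pos_of_ne_zero hn0) (Nat.pow_dvd_iff_dvd_floorRoot.mpr h)
      _ ≤ B := hB
  rw [filter_eq, ← coe_mul_zeta_apply, moebius_mul_coe_zeta, one_apply]
  simp only [isRFree_iff_floorRoot_eq_one]

open Classical in
theorem R_eq_card (H : ℝ) (r : ℕ) (k : ℤ) :
    R H r k = #{x ∈ Fintype.piFinset fun _ : Fin 3 => Icc 1 ⌊H⌋₊ |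
      IsRFree r (∑ i, (x i : ℤ) ^ 2 + k)} := by
  rw [R, ← card_filter_product_eq_piFinset]
  simp only [Fin.sum_univ_three, Matrix.cons_val]

theorem R_eq_sum_moebius {r : ℕ} (hr : r ≠ 0) (H : ℝ) (k : ℤ) {B : ℕ}
    (hB : 3 * ⌊H⌋₊ ^ 2 + k.natAbs ≤ B) :
    (R H r k : ℤ) = ∑ d ∈ Icc 1 B, moebius d * nonzeroCount ⌊H⌋₊ (d ^ r) k := by
  classical
  set X := {x ∈ Fintype.piFinset fun _ : Fin 3 => Icc 1 ⌊H⌋₊ | ∑ i, (x i : ℤ) ^ 2 + k ≠ 0} with hX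
  have R_eq : R H r k = #{x ∈ X | IsRFree r (∑ i, (x i : ℤ) ^ 2 + k)} := by
    rw [R_eq_card, hX, filter_filter]
    congr 2 with x
    exact ⟨fun h => ⟨h.ne_zero, h⟩, And.right⟩
  have indicator_eq : ∀ x ∈ X, (if IsRFree r (∑ i, (x i : ℤ) ^ 2 + k) then (1 : ℤ) else 0) =
      ∑ d ∈ Icc 1 B, if ((d ^ r : ℕ) : ℤ) ∣ ∑ i, (x i : ℤ) ^ 2 + k then moebius d else 0 := by
    intro x hx
    obtain ⟨hbox, hne⟩ := mem_filter.mp hx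
    rw [← sum_filter, sum_moebius_pow_dvd hr hne ((natAbs_sum_sq_add_le hbox k).trans hB)]
  rw [R_eq, natCast_card_filter, sum_congr rfl indicator_eq, sum_comm]
  refine sum_congr rfl fun d _ => ?_
  rw [← sum_filter, sum_const, filter_filter, nsmul_eq_mul, mul_comm, nonzeroCount]

end Moebius

section EulerProduct

open ArithmeticFunction

/-- The coefficients `μ(d) λ(d ^ r; k) / d ^ (3 r)` of the singular series. -/
noncomputable def singularCoeff (r : ℕ) (k : ℤ) (d : ℕ) : ℝ :=
  moebius d * (lam (d ^ r) k / ((d ^ r : ℕ) : ℝ) ^ 3)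

variable {r : ℕ} {k : ℤ}

@[simp]
theorem singularCoeff_zero : singularCoeff r k 0 = 0 := by
  simp [singularCoeff]

@[simp]
theorem singularCoeff_one : singularCoeff r k 1 = 1 := by
  simp [singularCoeff, lam_one]

theorem singularCoeff_of_not_squarefree {d : ℕ} (hd : ¬ Squarefree d) :
    singularCoeff r k d = 0 := by
  rw [singularCoeff, moebius_eq_zero_of_not_squarefree hd, Int.cast_zero, zero_mul]

theorem singularCoeff_mul {m n : ℕ} (hmn : m.Coprime n) :
    singularCoeff r k (m * n) = singularCoeff r k m * singularCoeff r k n := by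
  rcases eq_or_ne m 0 with rfl | hm
  · simp
  rcases eq_or_ne n 0 with rfl | hn
  · simp
  rw [singularCoeff, isMultiplicative_moebius.map_mul_of_coprime hmn, mul_pow,
    lam_mul (pow_ne_zero r hm) (pow_ne_zero r hn) (hmn.pow r r), singularCoeff, singularCoeff]
  push_cast
  ring

theorem tsum_singularCoeff_prime_pow (p : Nat.Primes) :
    ∑' e, singularCoeff r k ((p : ℕ) ^ e) = eulerFactor r k p := by
  rw [tsum_eq_sum (s := range 2)]
  · rw [sum_range_succ, sum_range_one, pow_zero, pow_one, singularCoeff_one, eulerFactor,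
      singularCoeff, moebius_apply_prime p.2]
    push_cast
    ring
  · intro e he
    have : 1 < e := by simpa using he
    refine singularCoeff_of_not_squarefree fun hsq => ?_
    have := (Nat.squarefree_pow_iff p.2.ne_one (by omega)).mp hsq
    omega

variable (r k)

theorem exists_singularCoeff_le {η : ℝ} (hη : 0 < η) :
    ∃ C : ℝ, 0 ≤ C ∧ ∀ d : ℕ, |singularCoeff r k d| ≤ C * (d : ℝ) ^ (η - r) := by
  obtain ⟨C, hC, lam_le⟩ := exists_lam_le r k hη
  refine ⟨C, hC, fun d => ?_⟩
  by_cases hd : Squarefree d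
  · have moebius_le : |(moebius d : ℝ)| ≤ 1 := by exact_mod_cast abs_moebius_le_one
    rw [singularCoeff, abs_mul, abs_of_nonneg (a := (lam (d ^ r) k : ℝ) / _) (by positivity)]
    exact (mul_le_of_le_one_left (by positivity) moebius_le).trans (lam_le d hd)
  · rw [singularCoeff_of_not_squarefree hd, abs_zero]
    positivity

variable {r}

theorem summable_norm_singularCoeff (hr : 2 ≤ r) : Summable fun d => ‖singularCoeff r k d‖ := by
  obtain ⟨C, -, hC⟩ := exists_singularCoeff_le r k one_half_pos
  have hr' : (2 : ℝ) ≤ r := by exact_mod_cast hr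
  exact .of_nonneg_of_le (fun _ => norm_nonneg _) hC
    ((Real.summable_nat_rpow.mpr (by linarith)).mul_left C)

theorem hasProd_eulerFactor (hr : 2 ≤ r) :
    HasProd (eulerFactor r k) (∑' d, singularCoeff r k d) := by
  simpa only [tsum_singularCoeff_prime_pow] using EulerProduct.eulerProduct_hasProd
    singularCoeff_one singularCoeff_mul (summable_norm_singularCoeff k hr) singularCoeff_zero

end EulerProduct

section RpowSums

theorem sum_rpow_le {D s : ℝ} (hD : 0 < D) (hs : 0 ≤ s) :
    ∑ d ∈ Icc 1 ⌊D⌋₊, (d : ℝ) ^ s ≤ D ^ (1 + s) := by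
  calc ∑ d ∈ Icc 1 ⌊D⌋₊, (d : ℝ) ^ s ≤ #(Icc 1 ⌊D⌋₊) • D ^ s :=
        sum_le_card_nsmul _ _ _ fun d hd => Real.rpow_le_rpow (Nat.cast_nonneg d)
          ((Nat.le_floor_iff hD.le).mp (mem_Icc.mp hd).2) hs
    _ ≤ D * D ^ s := by
        rw [nsmul_eq_mul, Nat.card_Icc, Nat.add_sub_cancel]
        gcongr
        exact Nat.floor_le hD.le
    _ = D ^ (1 + s) := by rw [Real.rpow_add hD, Real.rpow_one]

theorem sum_rpow_tail_le {D η s : ℝ} (hD : 0 < D) (hs : s ≤ -1 - η) (hη : 0 < η) {T : Finset ℕ}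
    (hT : ∀ d ∈ T, D ≤ d) :
    ∑ d ∈ T, (d : ℝ) ^ s ≤ D ^ (s + 1 + η) * ∑' d : ℕ, (d : ℝ) ^ (-1 - η) := by
  have hsum : Summable fun d : ℕ => (d : ℝ) ^ (-1 - η) :=
    Real.summable_nat_rpow.mpr (by linarith)
  calc ∑ d ∈ T, (d : ℝ) ^ s ≤ ∑ d ∈ T, D ^ (s + 1 + η) * (d : ℝ) ^ (-1 - η) := by
        refine sum_le_sum fun d hd => ?_
        have hd0 : (0 : ℝ) < d := hD.trans_le (hT d hd)
        calc (d : ℝ) ^ s = (d : ℝ) ^ (s + 1 + η) * (d : ℝ) ^ (-1 - η) := by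
              rw [← Real.rpow_add hd0]
              congr 1
              ring
          _ ≤ D ^ (s + 1 + η) * (d : ℝ) ^ (-1 - η) := mul_le_mul_of_nonneg_right
              (Real.rpow_le_rpow_of_nonpos hD (hT d hd) (by linarith)) (by positivity)
    _ = D ^ (s + 1 + η) * ∑ d ∈ T, (d : ℝ) ^ (-1 - η) := by rw [mul_sum]
    _ ≤ _ := by
        gcongr
        exact hsum.sum_le_tsum _ fun d _ => by positivity

theorem abs_sum_sub_tsum_le {a : ℕ → ℝ} {C D η s : ℝ} (hC : 0 ≤ C) (hD : 0 < D)
    (hs : s ≤ -1 - η) (hη : 0 < η) (ha : ∀ d, |a d| ≤ C * (d : ℝ) ^ s) {T : Finset ℕ}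
    (hT : ∀ d ∉ T, a d = 0 ∨ D ≤ d) :
    |∑ d ∈ T, a d - ∑' d, a d| ≤ C * (D ^ (s + 1 + η) * ∑' d : ℕ, (d : ℝ) ^ (-1 - η)) := by
  have hsum : Summable a := Summable.of_norm_bounded
    ((Real.summable_nat_rpow.mpr (by linarith : s < -1)).mul_left C) ha
  refine le_of_tendsto (tendsto_const_nhds.sub hsum.hasSum).abs ?_
  filter_upwards [Filter.eventually_ge_atTop T] with U hU
  rw [← sum_sdiff hU, sub_add_cancel_right, abs_neg]
  have drop_zeros : ∑ d ∈ U \ T, |a d| = ∑ d ∈ (U \ T).filter fun d : ℕ => D ≤ d, |a d| := by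
    refine (sum_filter_of_ne fun d hd hne => ?_).symm
    exact (hT d (mem_sdiff.mp hd).2).resolve_left (abs_ne_zero.mp hne)
  calc |∑ d ∈ U \ T, a d| ≤ ∑ d ∈ U \ T, |a d| := abs_sum_le_sum_abs _ _
    _ ≤ ∑ d ∈ (U \ T).filter fun d : ℕ => D ≤ d, C * (d : ℝ) ^ s :=
        drop_zeros.trans_le (sum_le_sum fun d _ => ha d)
    _ ≤ _ := by
        rw [← mul_sum]
        gcongr
        exact sum_rpow_tail_le hD hs hη fun d hd => (mem_filter.mp hd).2

end RpowSums

section Assembly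

open ArithmeticFunction

variable {r : ℕ} (k : ℤ) {η : ℝ}

theorem exists_sum_small_le (hr : 2 ≤ r) (hη : 0 < η) (hη' : η < 1) :
    ∃ C : ℝ, 0 ≤ C ∧ ∀ (N : ℕ) (D : ℝ), 0 < D →
      |∑ d ∈ Icc 1 ⌊D⌋₊,
        (moebius d * nonzeroCount N (d ^ r) k - (N : ℝ) ^ 3 * singularCoeff r k d)| ≤
        C * ((N : ℝ) ^ 2 + D ^ (1 + η + r)) := by
  obtain ⟨C, hC, error_le⟩ := exists_nonzeroCount_error_le (by omega : r ≠ 0) k hη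
  have hr' : (2 : ℝ) ≤ r := by exact_mod_cast hr
  have hsum : Summable fun d : ℕ => (d : ℝ) ^ (η - r) := Real.summable_nat_rpow.mpr (by linarith)
  set Z := ∑' d : ℕ, (d : ℝ) ^ (η - r)
  have hZ : 0 ≤ Z := tsum_nonneg fun d => by positivity
  refine ⟨C * (Z + 1), by positivity, fun N D hD => ?_⟩
  have term_le : ∀ d ∈ Icc 1 ⌊D⌋₊,
      |moebius d * nonzeroCount N (d ^ r) k - (N : ℝ) ^ 3 * singularCoeff r k d| ≤
        C * ((d : ℝ) ^ (η - r) * (N : ℝ) ^ 2 + (d : ℝ) ^ (η + r)) := by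
    intro d hdT
    have hd0 : (0 : ℝ) < d := by exact_mod_cast (mem_Icc.mp hdT).1
    by_cases hd : Squarefree d
    · have moebius_le : |(moebius d : ℝ)| ≤ 1 := by exact_mod_cast abs_moebius_le_one
      rw [singularCoeff, mul_left_comm, ← mul_sub, abs_mul, Real.rpow_sub hd0, Real.rpow_add hd0,
        Real.rpow_natCast]
      refine (mul_le_of_le_one_left (abs_nonneg _) moebius_le).trans
        ((error_le d hd N).trans_eq ?_)
      ring
    · rw [singularCoeff_of_not_squarefree hd, moebius_eq_zero_of_not_squarefree hd, Int.cast_zero,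
        zero_mul, mul_zero, sub_zero, abs_zero]
      positivity
  calc _ ≤ ∑ d ∈ Icc 1 ⌊D⌋₊, C * ((d : ℝ) ^ (η - r) * (N : ℝ) ^ 2 + (d : ℝ) ^ (η + r)) :=
        (abs_sum_le_sum_abs _ _).trans (sum_le_sum term_le)
    _ = C * ((∑ d ∈ Icc 1 ⌊D⌋₊, (d : ℝ) ^ (η - r)) * (N : ℝ) ^ 2 +
          ∑ d ∈ Icc 1 ⌊D⌋₊, (d : ℝ) ^ (η + r)) := by
        rw [← mul_sum, sum_add_distrib, sum_mul]
    _ ≤ C * (Z * (N : ℝ) ^ 2 + D ^ (1 + (η + r))) := by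
        gcongr
        · exact hsum.sum_le_tsum _ fun d _ => by positivity
        · exact sum_rpow_le hD (by positivity)
    _ ≤ C * (Z + 1) * ((N : ℝ) ^ 2 + D ^ (1 + η + r)) := by
        rw [mul_assoc, add_assoc 1 η]
        gcongr
        nlinarith [sq_nonneg (N : ℝ), mul_nonneg hZ (Real.rpow_nonneg hD.le (1 + (η + r)))]

theorem exists_sum_large_le (hr : 2 ≤ r) (hη : 0 < η) (hη' : η ≤ 1) :
    ∃ C : ℝ, 0 ≤ C ∧ ∀ (N : ℕ) (D : ℝ), 1 ≤ N → 0 < D → ∀ T : Finset ℕ, (∀ d ∈ T, D ≤ d) →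
      |∑ d ∈ T, (moebius d * nonzeroCount N (d ^ r) k : ℝ)| ≤
        C * ((N : ℝ) ^ (3 + η) * D ^ (1 + η - r)) := by
  obtain ⟨C, hC, count_le⟩ := exists_nonzeroCount_le k hη
  have hr' : (2 : ℝ) ≤ r := by exact_mod_cast hr
  refine ⟨C * ∑' d : ℕ, (d : ℝ) ^ (-1 - η), mul_nonneg hC (tsum_nonneg fun d => by positivity),
    fun N D hN hD T hT => ?_⟩
  have term_le : ∀ d ∈ T, |(moebius d * nonzeroCount N (d ^ r) k : ℝ)| ≤
      C * (N : ℝ) ^ (3 + η) * (d : ℝ) ^ (-r : ℝ) := by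
    intro d hd
    have hd0 : d ≠ 0 := by exact_mod_cast (hD.trans_le (hT d hd)).ne'
    have moebius_le : |(moebius d : ℝ)| ≤ 1 := by exact_mod_cast abs_moebius_le_one
    rw [abs_mul, Nat.abs_cast, Real.rpow_neg (Nat.cast_nonneg d), Real.rpow_natCast,
      ← div_eq_mul_inv, ← Nat.cast_pow]
    exact (mul_le_of_le_one_left (Nat.cast_nonneg _) moebius_le).trans
      (count_le N (d ^ r) hN (pow_ne_zero r hd0))
  calc _ ≤ ∑ d ∈ T, C * (N : ℝ) ^ (3 + η) * (d : ℝ) ^ (-r : ℝ) :=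
        (abs_sum_le_sum_abs _ _).trans (sum_le_sum term_le)
    _ ≤ C * (N : ℝ) ^ (3 + η) * (D ^ (-r + 1 + η) * ∑' d : ℕ, (d : ℝ) ^ (-1 - η)) := by
        rw [← mul_sum]
        gcongr
        exact sum_rpow_tail_le hD (by linarith) hη hT
    _ = _ := by
        rw [show -(r : ℝ) + 1 + η = 1 + η - r by ring]
        ring

theorem exists_sum_singularCoeff_sub_le (hr : 2 ≤ r) (hη : 0 < η) (hη' : η ≤ 1 / 2) :
    ∃ C : ℝ, 0 ≤ C ∧ ∀ D : ℝ, 0 < D →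
      |∑ d ∈ Icc 1 ⌊D⌋₊, singularCoeff r k d - ∑' d, singularCoeff r k d| ≤
        C * D ^ (1 + 2 * η - r) := by
  obtain ⟨C, hC, coeff_le⟩ := exists_singularCoeff_le r k hη
  have hr' : (2 : ℝ) ≤ r := by exact_mod_cast hr
  refine ⟨C * ∑' d : ℕ, (d : ℝ) ^ (-1 - η), mul_nonneg hC (tsum_nonneg fun d => by positivity),
    fun D hD => ?_⟩
  refine (abs_sum_sub_tsum_le hC hD (by linarith) hη coeff_le fun d hd => ?_).trans_eq ?_
  · rcases eq_or_ne d 0 with rfl | hd0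
    · exact .inl singularCoeff_zero
    · refine .inr (Nat.lt_of_floor_lt (not_le.mp fun h => hd ?_)).le
      exact mem_Icc.mpr ⟨Nat.one_le_iff_ne_zero.mpr hd0, h⟩
  · rw [show η - (r : ℝ) + 1 + η = 1 + 2 * η - r by ring]
    ring

theorem R_sub_eq (hr : r ≠ 0) (H P : ℝ) {B : ℕ} (hB : 3 * ⌊H⌋₊ ^ 2 + k.natAbs ≤ B)
    {T : Finset ℕ} (hT : T ⊆ Icc 1 B) :
    R H r k - P * (⌊H⌋₊ : ℝ) ^ 3 =
      ∑ d ∈ T, (moebius d * nonzeroCount ⌊H⌋₊ (d ^ r) k - (⌊H⌋₊ : ℝ) ^ 3 * singularCoeff r k d) +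
        ∑ d ∈ Icc 1 B \ T, (moebius d * nonzeroCount ⌊H⌋₊ (d ^ r) k : ℝ) +
        (⌊H⌋₊ : ℝ) ^ 3 * (∑ d ∈ T, singularCoeff r k d - P) := by
  have R_eq : (R H r k : ℝ) = ∑ d ∈ Icc 1 B, (moebius d * nonzeroCount ⌊H⌋₊ (d ^ r) k : ℝ) := by
    exact_mod_cast R_eq_sum_moebius hr H k hB
  rw [R_eq, ← sum_sdiff hT, sum_sub_distrib, ← mul_sum]
  ring

theorem abs_floor_cube_sub_cube_le {x : ℝ} (hx : 0 ≤ x) :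
    |(⌊x⌋₊ : ℝ) ^ 3 - x ^ 3| ≤ 3 * x ^ 2 := by
  have floor_le := Nat.floor_le hx
  have lt_floor := Nat.lt_floor_add_one x
  have : (0 : ℝ) ≤ ⌊x⌋₊ := Nat.cast_nonneg _
  rw [abs_sub_comm, abs_of_nonneg (sub_nonneg.mpr (by gcongr))]
  calc x ^ 3 - (⌊x⌋₊ : ℝ) ^ 3 = (x - ⌊x⌋₊) * (x * x + x * ⌊x⌋₊ + ⌊x⌋₊ * ⌊x⌋₊) := by ring
    _ ≤ 1 * (x * x + x * x + x * x) := by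
        gcongr
        linarith
    _ = 3 * x ^ 2 := by ring

theorem exists_abs_R_sub_floor_le (hr : 2 ≤ r) (hη : 0 < η) (hη' : η ≤ 1 / 2) :
    ∃ C : ℝ, 0 ≤ C ∧ ∀ H D : ℝ, 1 ≤ H → 1 ≤ D →
      |R H r k - (∑' d, singularCoeff r k d) * (⌊H⌋₊ : ℝ) ^ 3| ≤
        C * (H ^ 2 + D ^ (1 + η + r) + H ^ (3 + η) * D ^ (1 + 2 * η - r)) := by
  obtain ⟨C₁, hC₁, small_le⟩ := exists_sum_small_le k hr hη (by linarith)
  obtain ⟨C₂, hC₂, large_le⟩ := exists_sum_large_le k hr hη (by linarith)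
  obtain ⟨C₃, hC₃, series_le⟩ := exists_sum_singularCoeff_sub_le k hr hη hη'
  refine ⟨C₁ + C₂ + C₃, by positivity, fun H D hH hD => ?_⟩
  have hD0 : 0 < D := zero_lt_one.trans_le hD
  have hN : 1 ≤ ⌊H⌋₊ := Nat.floor_pos.mpr hH
  have hNH : (⌊H⌋₊ : ℝ) ≤ H := Nat.floor_le (by positivity)
  have floor_cube_le : (⌊H⌋₊ : ℝ) ^ 3 ≤ H ^ (3 + η) := by
    rw [← Real.rpow_natCast]
    exact (Real.rpow_le_rpow (by positivity) hNH (by positivity)).trans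
      (Real.rpow_le_rpow_of_exponent_le hH (by push_cast; linarith))
  set B := 3 * ⌊H⌋₊ ^ 2 + k.natAbs + ⌊D⌋₊
  have hT : Icc 1 ⌊D⌋₊ ⊆ Icc 1 B := Icc_subset_Icc_right (Nat.le_add_left _ _)
  have hlarge : ∀ d ∈ Icc 1 B \ Icc 1 ⌊D⌋₊, D ≤ d := fun d hd => by
    simp only [mem_sdiff, mem_Icc, not_and, not_le] at hd
    exact (Nat.lt_of_floor_lt (hd.2 hd.1.1)).le
  have floor_rpow_le :
      (⌊H⌋₊ : ℝ) ^ (3 + η) * D ^ (1 + η - r) ≤ H ^ (3 + η) * D ^ (1 + 2 * η - r) := by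
    gcongr
    linarith
  rw [R_sub_eq k (by omega) H _ (Nat.le_add_right _ _) hT]
  calc _ ≤ C₁ * ((⌊H⌋₊ : ℝ) ^ 2 + D ^ (1 + η + r)) +
        C₂ * ((⌊H⌋₊ : ℝ) ^ (3 + η) * D ^ (1 + η - r)) +
        (⌊H⌋₊ : ℝ) ^ 3 * (C₃ * D ^ (1 + 2 * η - r)) := by
        refine (abs_add_three _ _ _).trans (add_le_add_three (small_le _ D hD0)
          (large_le _ D hN hD0 _ hlarge) ?_)
        rw [abs_mul, abs_of_nonneg (a := (⌊H⌋₊ : ℝ) ^ 3) (by positivity)]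
        gcongr
        exact series_le D hD0
    _ ≤ C₁ * (H ^ 2 + D ^ (1 + η + r)) + C₂ * (H ^ (3 + η) * D ^ (1 + 2 * η - r)) +
        H ^ (3 + η) * (C₃ * D ^ (1 + 2 * η - r)) := by gcongr
    _ ≤ (C₁ + C₂ + C₃) * (H ^ 2 + D ^ (1 + η + r) + H ^ (3 + η) * D ^ (1 + 2 * η - r)) := by
        rw [add_mul, add_mul, mul_left_comm (H ^ (3 + η))]
        gcongr C₁ * ?_ + C₂ * ?_ + C₃ * ?_
        exacts [le_add_of_nonneg_right (by positivity), le_add_of_nonneg_left (by positivity),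
          le_add_of_nonneg_left (by positivity)]

theorem exists_abs_R_sub_le (hr : 2 ≤ r) (hη : 0 < η) (hη' : η ≤ 1 / 2) :
    ∃ C : ℝ, 0 ≤ C ∧ ∀ H D : ℝ, 1 ≤ H → 1 ≤ D →
      |R H r k - (∑' d, singularCoeff r k d) * H ^ 3| ≤
        C * (H ^ 2 + D ^ (1 + η + r) + H ^ (3 + η) * D ^ (1 + 2 * η - r)) := by
  obtain ⟨C, hC, floor_le⟩ := exists_abs_R_sub_floor_le k hr hη hη'
  set P := ∑' d, singularCoeff r k d
  refine ⟨C + 3 * |P|, by positivity, fun H D hH hD => ?_⟩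
  set F := H ^ 2 + D ^ (1 + η + r) + H ^ (3 + η) * D ^ (1 + 2 * η - r)
  have sq_le : H ^ 2 ≤ F :=
    le_add_of_le_of_nonneg (le_add_of_nonneg_right (by positivity)) (by positivity)
  calc |R H r k - P * H ^ 3|
      ≤ |R H r k - P * (⌊H⌋₊ : ℝ) ^ 3| + |P| * |(⌊H⌋₊ : ℝ) ^ 3 - H ^ 3| := by
        rw [← abs_mul, mul_sub]
        exact abs_sub_le _ _ _
    _ ≤ C * F + |P| * (3 * F) := by
        gcongr
        · exact floor_le H D hH hD
        · exact (abs_floor_cube_sub_cube_le (by positivity)).trans (by gcongr)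
    _ = (C + 3 * |P|) * F := by ring

theorem exists_abs_R_sub_tsum_le (hr : 2 ≤ r) {ε : ℝ} (hε : 0 < ε) :
    ∃ C : ℝ, 0 ≤ C ∧ ∀ H : ℝ, 1 ≤ H →
      |R H r k - (∑' d, singularCoeff r k d) * H ^ 3| ≤
        C * (H ^ 2 + H ^ ((3 : ℝ) / 2 + 3 / (2 * (r : ℝ)) + ε)) := by
  have hη : 0 < min (ε / 4) (1 / 2) := by positivity
  obtain ⟨C, hC, error_le⟩ := exists_abs_R_sub_le k hr hη (min_le_right _ _)
  set η := min (ε / 4) (1 / 2)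
  have hηε : η ≤ ε / 4 := min_le_left _ _
  refine ⟨C * 2, by positivity, fun H hH => ?_⟩
  have hH0 : 0 < H := by positivity
  have hr' : (2 : ℝ) ≤ r := by exact_mod_cast hr
  set κ := 3 / (2 * (r : ℝ)) with hκ
  have hκ0 : 0 < κ := by positivity
  have hκ1 : κ ≤ 1 := (div_le_one (by positivity)).mpr (by linarith)
  have hκr : κ * r = 3 / 2 := by
    rw [hκ]
    field_simp
  have hκη : κ * η ≤ η := mul_le_of_le_one_left hη.le hκ1
  have hκε : 3 * η ≤ ε := by linarith
  have small_le : (H ^ κ) ^ (1 + η + r) ≤ H ^ (3 / 2 + κ + ε) := by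
    rw [← Real.rpow_mul hH0.le]
    exact Real.rpow_le_rpow_of_exponent_le hH (by linear_combination hκr + hκη + hκε + 2 * hη)
  have large_le : H ^ (3 + η) * (H ^ κ) ^ (1 + 2 * η - r) ≤ H ^ (3 / 2 + κ + ε) := by
    rw [← Real.rpow_mul hH0.le, ← Real.rpow_add hH0]
    exact Real.rpow_le_rpow_of_exponent_le hH (by linear_combination -hκr + 2 * hκη + hκε)
  calc _ ≤ C * (H ^ 2 + (H ^ κ) ^ (1 + η + r) + H ^ (3 + η) * (H ^ κ) ^ (1 + 2 * η - r)) :=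
        error_le H (H ^ κ) hH (Real.one_le_rpow hH hκ0.le)
    _ ≤ C * (2 * H ^ 2 + 2 * H ^ (3 / 2 + κ + ε)) := by
        gcongr C * ?_
        linarith [sq_nonneg H]
    _ = C * 2 * (H ^ 2 + H ^ (3 / 2 + κ + ε)) := by ring

theorem sq_add_rpow_le_rpow_add_rpow (hr : 2 ≤ r) {ε H : ℝ} (hε : 0 < ε) (hH : 1 ≤ H) :
    H ^ 2 + H ^ ((3 : ℝ) / 2 + 3 / (2 * (r : ℝ)) + ε) ≤
      H ^ ((2 : ℝ) + ε) + H ^ (9 * (r : ℝ) / (5 * (r : ℝ) - 2) + ε) := by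
  have hr' : (2 : ℝ) ≤ r := by exact_mod_cast hr
  have exponent_le : (3 : ℝ) / 2 + 3 / (2 * (r : ℝ)) ≤ 9 * r / (5 * r - 2) := by
    rw [div_add_div _ _ (by norm_num) (by positivity),
      div_le_div_iff₀ (by positivity) (by linarith)]
    nlinarith [mul_nonneg (sub_nonneg.mpr hr') (show (0 : ℝ) ≤ (r : ℝ) - 1 by linarith)]
  rw [← Real.rpow_two]
  gcongr
  · linarith

end Assembly

end RFreeValues

theorem theorem1_general (r : ℕ) (hr : 2 ≤ r) (k : ℤ) :
    Multipliable (RFreeValues.eulerFactor r k) ∧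
    ∀ ε : ℝ, 0 < ε → ∃ C : ℝ, 0 ≤ C ∧ ∀ H : ℝ, 1 ≤ H →
      |(RFreeValues.R H r k : ℝ) - (∏' p : Nat.Primes, RFreeValues.eulerFactor r k p) * H ^ 3|
        ≤ C * (H ^ 2 + H ^ ((3 : ℝ) / 2 + 3 / (2 * (r : ℝ)) + ε)) := by
  have euler_product := RFreeValues.hasProd_eulerFactor k hr
  refine ⟨euler_product.multipliable, fun ε hε => ?_⟩
  rw [euler_product.tprod_eq]
  exact RFreeValues.exists_abs_R_sub_tsum_le k hr hε

theorem theorem1 (r : ℕ) (hr : 2 ≤ r) (k : ℤ) :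
    Multipliable (RFreeValues.eulerFactor r k) ∧
    (k ≠ 0 → ∀ ε : ℝ, 0 < ε → ∃ C : ℝ, ∀ H : ℝ, 1 ≤ H →
      |(RFreeValues.R H r k : ℝ) - (∏' p : Nat.Primes, RFreeValues.eulerFactor r k p) * H ^ 3|
        ≤ C * (H ^ 2 + H ^ ((3 : ℝ) / 2 + 3 / (2 * (r : ℝ)) + ε))) ∧
    (k = 0 → ∀ ε : ℝ, 0 < ε → ∃ C : ℝ, ∀ H : ℝ, 1 ≤ H →
      |(RFreeValues.R H r k : ℝ) - (∏' p : Nat.Primes, RFreeValues.eulerFactor r k p) * H ^ 3|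
        ≤ C * (H ^ ((2 : ℝ) + ε) + H ^ (9 * (r : ℝ) / (5 * (r : ℝ) - 2) + ε))) :=
  (theorem1_general r hr k).imp_right fun h => ⟨fun _ ε hε => (h ε hε).imp fun _ => And.right,
    fun _ ε hε => (h ε hε).imp fun _ ⟨hC, hR⟩ H hH => (hR H hH).trans
      (mul_le_mul_of_nonneg_left (RFreeValues.sq_add_rpow_le_rpow_add_rpow hr hε hH) hC)⟩
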